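/- Let $\mu$ be Lebesgue measure on $[0,1]$ and let $r>0$. A \emph{graphon} is a measurable function $W:[0,1]^2\to[0,1]$ with $W(x,y)=W(y,x)$ for all $x,y$; a \emph{signal} is a measurable function $f:[0,1]\to\mathbb{R}$ with $|f(x)|\le r$ for all $x$. Let $\mathcal{WL}_r$ be the set of pairs $(W,f)$ of a graphon and a signal (\emph{graphon-signals}). For integrable $W:[0,1]^2\to\mathbb{R}$ and $f:[0,1]\to\mathbb{R}$ put $$\|W\|_\square=\sup_{U,S}\Big|\int_{U\times S}W(x,y)\,dx\,dy\Big|,\qquad \|f\|_\square=\sup_{S}\Big|\int_S f\,d\mu\Big|,\qquad \|(W,f)\|_\square=\|W\|_\square+\|f\|_\square,$$ where $U,S$ range over the measurable subsets of $[0,1]$. Let $S'_{[0,1]}$ be the set of bijections $\phi:A\to B$ between measurable co-null subsets $A,B$ of $[0,1]$ that are measurable with measurable inverse and satisfy $\mu(\phi(S))=\mu(S)$ for all measurable $S\subseteq A$. For such $\phi$ put $W^\phi(x,y)=W(\phi(x),\phi(y))$ and $f^\phi(x)=f(\phi(x))$ where these are defined, and $0$ elsewhere. The \emph{cut distance} on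 $\mathcal{WL}_r$ is $$\delta_\square\big((W,f),(V,g)\big)=\inf_{\phi\in S'_{[0,1]}}\big\|(W-V^\phi,\;f-g^\phi)\big\|_\square .$$ It is a pseudometric. Let $\widetilde{\mathcal{WL}_r}$ be the quotient of $\mathcal{WL}_r$ by the relation $\delta_\square=0$, with the metric induced by $\delta_\square$. Then the metric space $(\widetilde{\mathcal{WL}_r},\delta_\square)$ is compact. Moreover, for every $c>1$ there is $\epsilon_0>0$ (depending only on $r$ and $c$) such that for every $0<\epsilon<\epsilon_0$ the space $\widetilde{\mathcal{WL}_r}$ can be covered by $$\kappa(\epsilon)=2^{k^2},\qquad k=\big\lceil 2^{\frac{9c}{4\epsilon^2}}\big\rceil,$$ open balls of radius $\epsilon$. -/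

import Mathlib

open MeasureTheory Set
open scoped unitInterval

noncomputable section

namespace GraphonSignalSpace

/-- A graphon: a symmetric measurable function `[0,1]² → [0,1]`. -/
structure Graphon where
  toFun : I × I → ℝ
  measurable : Measurable toFun
  mem_Icc : ∀ p, toFun p ∈ Icc (0 : ℝ) 1
  symm : ∀ x y, toFun (x, y) = toFun (y, x)

/-- A signal bounded by `r`: a measurable function `[0,1] → ℝ` with `|f x| ≤ r` everywhere. -/
structure Signal (r : ℝ) where
  toFun : I → ℝ
  measurable : Measurable toFun
  abs_le : ∀ x, |toFun x| ≤ r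

/-- A graphon-signal: a pair of a graphon and a signal bounded by `r`. -/
structure GraphonSignal (r : ℝ) where
  graphon : Graphon
  signal : Signal r

/-- The cut norm of a kernel on `[0,1]²`. -/
def kernelCutNorm (W : I × I → ℝ) : ℝ :=
  sSup {a | ∃ U S : Set I, MeasurableSet U ∧ MeasurableSet S ∧ a = |∫ p in U ×ˢ S, W p|}

/-- The cut norm of a signal on `[0,1]`. -/
def signalCutNorm (f : I → ℝ) : ℝ :=
  sSup {a | ∃ S : Set I, MeasurableSet S ∧ a = |∫ x in S, f x|}

/-- The cut norm of a pair `(W, f)`. -/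
def cutNorm (W : I × I → ℝ) (f : I → ℝ) : ℝ :=
  kernelCutNorm W + signalCutNorm f

/-- A measurable (in both directions) measure preserving bijection between two measurable co-null
subsets `source` and `target` of `[0,1]`. The values outside `source` and `target` are irrelevant. -/
structure CoNullBijection extends PartialEquiv I I where
  measurableSet_source : MeasurableSet source
  measurableSet_target : MeasurableSet target
  source_conull : volume sourceᶜ = 0
  target_conull : volume targetᶜ = 0
  measurable_toFun : Measurable fun x : ↥source => toFun x
  measurable_invFun : Measurable fun x : ↥target => invFun x
  measure_image : ∀ S ⊆ source, MeasurableSet S → volume (toFun '' S) = volume S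

/-- `W^φ(x, y) = W(φ x, φ y)`, set to `0` where it is not defined. -/
def kernelPull (φ : CoNullBijection) (W : I × I → ℝ) : I × I → ℝ :=
  (φ.source ×ˢ φ.source).indicator fun p => W (φ.toFun p.1, φ.toFun p.2)

/-- `f^φ(x) = f(φ x)`, set to `0` where it is not defined. -/
def signalPull (φ : CoNullBijection) (f : I → ℝ) : I → ℝ :=
  φ.source.indicator fun x => f (φ.toFun x)

/-- The cut distance between two graphon-signals: the infimum over `φ` of the cut norm of
`(W, f) - (V, g)^φ`. -/
def cutDistance {r : ℝ} (a b : GraphonSignal r) : ℝ :=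
  sInf (range fun φ : CoNullBijection =>
    cutNorm (a.graphon.toFun - kernelPull φ b.graphon.toFun)
      (a.signal.toFun - signalPull φ b.signal.toFun))

/-! ### The cut distance is a pseudometric -/

namespace CoNullBijection

/-- The identity of `[0,1]`. -/
def refl : CoNullBijection where
  toPartialEquiv := PartialEquiv.refl I
  measurableSet_source := MeasurableSet.univ
  measurableSet_target := MeasurableSet.univ
  source_conull := by simp
  target_conull := by simp
  measurable_toFun := measurable_subtype_coe
  measurable_invFun := measurable_subtype_coe
  measure_image := by intro S _ _; exact congrArg volume (image_id S)

theorem measurableSet_preimage_inter (φ : CoNullBijection) {T : Set I} (hT : MeasurableSet T) :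
    MeasurableSet (φ.source ∩ φ.toFun ⁻¹' T) := by
  have h := MeasurableSet.subtype_image φ.measurableSet_source (φ.measurable_toFun hT)
  convert h using 1
  ext x; simp [and_comm]

theorem measurableSet_preimage_inv_inter (φ : CoNullBijection) {T : Set I}
    (hT : MeasurableSet T) : MeasurableSet (φ.target ∩ φ.invFun ⁻¹' T) := by
  have h := MeasurableSet.subtype_image φ.measurableSet_target (φ.measurable_invFun hT)
  convert h using 1
  ext x; simp [and_comm]

/-- The inverse bijection. -/
def symm (φ : CoNullBijection) : CoNullBijection where
  toPartialEquiv := φ.toPartialEquiv.symm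
  measurableSet_source := φ.measurableSet_target
  measurableSet_target := φ.measurableSet_source
  source_conull := φ.target_conull
  target_conull := φ.source_conull
  measurable_toFun := φ.measurable_invFun
  measurable_invFun := φ.measurable_toFun
  measure_image := by
    intro S hS hSm
    have hS' : S ⊆ φ.target := hS
    have e : φ.invFun '' S = φ.source ∩ φ.toFun ⁻¹' S :=
      φ.toPartialEquiv.symm_image_eq_source_inter_preimage hS'
    have h := φ.measure_image (φ.invFun '' S) (by rw [e]; exact inter_subset_left)
      (by rw [e]; exact φ.measurableSet_preimage_inter hSm)
    change volume (φ.invFun '' S) = volume S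
    rw [← h, image_image]
    congr 1
    ext y
    constructor
    · rintro ⟨x, hx, rfl⟩
      change φ.toPartialEquiv (φ.toPartialEquiv.symm x) ∈ S
      rwa [φ.toPartialEquiv.right_inv (hS' hx)]
    · intro hy
      exact ⟨y, hy, φ.toPartialEquiv.right_inv (hS' hy)⟩

/-- An everywhere defined extension, by the identity, of `φ`. -/
def ext (φ : CoNullBijection) : I → I :=
  open Classical in φ.source.piecewise φ.toFun id

theorem ext_of_mem (φ : CoNullBijection) {x : I} (hx : x ∈ φ.source) : φ.ext x = φ.toFun x := by
  simp [ext, hx]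

theorem measurable_ext (φ : CoNullBijection) : Measurable φ.ext := by
  classical
  refine measurable_of_restrict_of_restrict_compl φ.measurableSet_source ?_ ?_
  · convert φ.measurable_toFun using 1
    ext x; simp [ext, x.2]
  · convert (measurable_subtype_coe : Measurable ((↑) : ↥(φ.sourceᶜ) → I)) using 1
    funext x
    have : (x : I) ∉ φ.source := x.2
    simp [ext, this]

theorem ae_mem_source (φ : CoNullBijection) : ∀ᵐ x : I, x ∈ φ.source :=
  mem_ae_iff.2 φ.source_conull

theorem ae_mem_target (φ : CoNullBijection) : ∀ᵐ x : I, x ∈ φ.target :=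
  mem_ae_iff.2 φ.target_conull

theorem measurePreserving_ext (φ : CoNullBijection) : MeasurePreserving φ.ext := by
  refine ⟨φ.measurable_ext, ?_⟩
  refine Measure.ext fun T hT => ?_
  rw [Measure.map_apply φ.measurable_ext hT]
  have h1 : volume (φ.ext ⁻¹' T) = volume (φ.source ∩ φ.toFun ⁻¹' T) := by
    apply measure_congr
    filter_upwards [φ.ae_mem_source] with x hx
    apply propext
    change φ.ext x ∈ T ↔ (x ∈ φ.source ∧ φ.toFun x ∈ T)
    rw [φ.ext_of_mem hx]; tauto
  rw [h1, ← φ.measure_image _ inter_subset_left (φ.measurableSet_preimage_inter hT)]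
  have h2 : φ.toFun '' (φ.source ∩ φ.toFun ⁻¹' T) = φ.target ∩ T := by
    rw [image_inter_preimage]
    congr 1
    exact φ.toPartialEquiv.image_source_eq_target
  rw [h2]
  apply measure_congr
  filter_upwards [φ.ae_mem_target] with x hx
  apply propext
  change (x ∈ φ.target ∧ x ∈ T) ↔ x ∈ T
  tauto

/-- The composition "first `φ`, then `ψ`", on the points where it makes sense. -/
def trans (φ ψ : CoNullBijection) : CoNullBijection where
  toPartialEquiv := φ.toPartialEquiv.trans ψ.toPartialEquiv
  measurableSet_source := φ.measurableSet_preimage_inter ψ.measurableSet_source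
  measurableSet_target := ψ.measurableSet_preimage_inv_inter φ.measurableSet_target
  source_conull := by
    rw [← mem_ae_iff]
    filter_upwards [φ.ae_mem_source, φ.measurePreserving_ext.quasiMeasurePreserving.ae
      ψ.ae_mem_source] with x hx hx'
    rw [φ.ext_of_mem hx] at hx'
    exact ⟨hx, hx'⟩
  target_conull := by
    rw [← mem_ae_iff]
    filter_upwards [ψ.symm.ae_mem_source, ψ.symm.measurePreserving_ext.quasiMeasurePreserving.ae
      φ.symm.ae_mem_source] with x hx hx'
    rw [ψ.symm.ext_of_mem hx] at hx'
    exact ⟨hx, hx'⟩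
  measurable_toFun := by
    have h : Measurable fun x : ↥(φ.toPartialEquiv.trans ψ.toPartialEquiv).source =>
        ψ.ext (φ.ext x) := ψ.measurable_ext.comp (φ.measurable_ext.comp measurable_subtype_coe)
    convert h using 1
    funext x
    have hx : (x : I) ∈ φ.source := x.2.1
    have hx' : φ.toFun x ∈ ψ.source := x.2.2
    rw [φ.ext_of_mem hx, ψ.ext_of_mem hx']
    rfl
  measurable_invFun := by
    have h : Measurable fun x : ↥(φ.toPartialEquiv.trans ψ.toPartialEquiv).target =>
        φ.symm.ext (ψ.symm.ext x) :=
      φ.symm.measurable_ext.comp (ψ.symm.measurable_ext.comp measurable_subtype_coe)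
    convert h using 1
    funext x
    have hx : (x : I) ∈ ψ.symm.source := x.2.1
    have hx' : ψ.symm.toFun x ∈ φ.symm.source := x.2.2
    rw [ψ.symm.ext_of_mem hx, φ.symm.ext_of_mem hx']
    rfl
  measure_image := by
    intro S hS hSm
    have hS1 : S ⊆ φ.source := fun x hx => (hS hx).1
    have hS2 : φ.toFun '' S ⊆ ψ.source := by
      rintro _ ⟨x, hx, rfl⟩
      exact (hS hx).2
    have e : φ.toFun '' S = φ.target ∩ φ.invFun ⁻¹' S :=
      φ.toPartialEquiv.image_eq_target_inter_inv_preimage hS1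
    have e' : (φ.toPartialEquiv.trans ψ.toPartialEquiv).toFun '' S = ψ.toFun '' (φ.toFun '' S) := by
      rw [image_image]; rfl
    rw [e', ψ.measure_image _ hS2 (by rw [e]; exact φ.measurableSet_preimage_inv_inter hSm),
      φ.measure_image S hS1 hSm]

end CoNullBijection

theorem signalPull_ae (φ : CoNullBijection) (f : I → ℝ) :
    signalPull φ f =ᵐ[volume] f ∘ φ.ext := by
  filter_upwards [φ.ae_mem_source] with x hx
  simp [signalPull, hx, φ.ext_of_mem hx]

theorem ae_prod_of_ae {P : I → Prop} (h : ∀ᵐ x : I, P x) :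
    ∀ᵐ p : I × I, P p.1 ∧ P p.2 := by
  have h1 : ∀ᵐ p : I × I, P p.1 := Measure.quasiMeasurePreserving_fst.ae h
  have h2 : ∀ᵐ p : I × I, P p.2 := Measure.quasiMeasurePreserving_snd.ae h
  exact h1.and h2

theorem kernelPull_ae (φ : CoNullBijection) (W : I × I → ℝ) :
    kernelPull φ W =ᵐ[volume] W ∘ Prod.map φ.ext φ.ext := by
  filter_upwards [ae_prod_of_ae φ.ae_mem_source] with p hp
  simp [kernelPull, Prod.map, hp.1, hp.2, φ.ext_of_mem hp.1, φ.ext_of_mem hp.2]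

theorem measurePreserving_prod (φ : CoNullBijection) :
    MeasurePreserving (Prod.map φ.ext φ.ext) (volume : Measure (I × I)) volume :=
  φ.measurePreserving_ext.prod φ.measurePreserving_ext

theorem kernelCutNorm_congr {W V : I × I → ℝ} (h : W =ᵐ[volume] V) :
    kernelCutNorm W = kernelCutNorm V := by
  unfold kernelCutNorm
  congr 1
  ext a
  have (U S : Set I) : ∫ p in U ×ˢ S, W p = ∫ p in U ×ˢ S, V p :=
    integral_congr_ae (ae_restrict_of_ae h)
  simp only [this]

theorem signalCutNorm_congr {f g : I → ℝ} (h : f =ᵐ[volume] g) :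
    signalCutNorm f = signalCutNorm g := by
  unfold signalCutNorm
  congr 1
  ext a
  have (S : Set I) : ∫ p in S, f p = ∫ p in S, g p :=
    integral_congr_ae (ae_restrict_of_ae h)
  simp only [this]

theorem abs_setIntegral_le {α : Type*} [MeasurableSpace α] {μ : Measure α} {f : α → ℝ}
    (hf : Integrable f μ) (s : Set α) : |∫ x in s, f x ∂μ| ≤ ∫ x, |f x| ∂μ :=
  (abs_integral_le_integral_abs).trans
    (setIntegral_le_integral hf.abs (Filter.Eventually.of_forall fun _ => abs_nonneg _))

theorem kernelCutNorm_bdd {W : I × I → ℝ} (hW : Integrable W) :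
    BddAbove {a | ∃ U S : Set I, MeasurableSet U ∧ MeasurableSet S ∧
      a = |∫ p in U ×ˢ S, W p|} := by
  refine ⟨∫ p, |W p|, ?_⟩
  rintro _ ⟨U, S, -, -, rfl⟩
  exact abs_setIntegral_le hW _

theorem signalCutNorm_bdd {f : I → ℝ} (hf : Integrable f) :
    BddAbove {a | ∃ S : Set I, MeasurableSet S ∧ a = |∫ x in S, f x|} := by
  refine ⟨∫ p, |f p|, ?_⟩
  rintro _ ⟨S, -, rfl⟩
  exact abs_setIntegral_le hf _

theorem le_kernelCutNorm {W : I × I → ℝ} (hW : Integrable W) {U S : Set I}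
    (hU : MeasurableSet U) (hS : MeasurableSet S) :
    |∫ p in U ×ˢ S, W p| ≤ kernelCutNorm W :=
  le_csSup (kernelCutNorm_bdd hW) ⟨U, S, hU, hS, rfl⟩

theorem le_signalCutNorm {f : I → ℝ} (hf : Integrable f) {S : Set I} (hS : MeasurableSet S) :
    |∫ x in S, f x| ≤ signalCutNorm f :=
  le_csSup (signalCutNorm_bdd hf) ⟨S, hS, rfl⟩

theorem kernelCutNorm_le {W : I × I → ℝ} {a : ℝ}
    (h : ∀ U S : Set I, MeasurableSet U → MeasurableSet S → |∫ p in U ×ˢ S, W p| ≤ a) :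
    kernelCutNorm W ≤ a := by
  refine csSup_le ⟨_, ∅, ∅, MeasurableSet.empty, MeasurableSet.empty, rfl⟩ ?_
  rintro _ ⟨U, S, hU, hS, rfl⟩
  exact h U S hU hS

theorem signalCutNorm_le {f : I → ℝ} {a : ℝ}
    (h : ∀ S : Set I, MeasurableSet S → |∫ x in S, f x| ≤ a) : signalCutNorm f ≤ a := by
  refine csSup_le ⟨_, ∅, MeasurableSet.empty, rfl⟩ ?_
  rintro _ ⟨S, hS, rfl⟩
  exact h S hS

theorem cutNorm_nonneg (W : I × I → ℝ) (f : I → ℝ) : 0 ≤ cutNorm W f := by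
  refine add_nonneg (Real.sSup_nonneg ?_) (Real.sSup_nonneg ?_)
  · rintro _ ⟨U, S, -, -, rfl⟩; exact abs_nonneg _
  · rintro _ ⟨S, -, rfl⟩; exact abs_nonneg _

theorem cutNorm_zero : cutNorm 0 0 = 0 := by
  refine le_antisymm ?_ (cutNorm_nonneg _ _)
  have h1 : kernelCutNorm 0 ≤ 0 := kernelCutNorm_le fun U S _ _ => by simp
  have h2 : signalCutNorm 0 ≤ 0 := signalCutNorm_le fun S _ => by simp
  unfold cutNorm; linarith

theorem cutNorm_congr {W V : I × I → ℝ} {f g : I → ℝ} (h : W =ᵐ[volume] V)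
    (h' : f =ᵐ[volume] g) : cutNorm W f = cutNorm V g := by
  rw [cutNorm, cutNorm, kernelCutNorm_congr h, signalCutNorm_congr h']

theorem cutNorm_sub_comm (W V : I × I → ℝ) (f g : I → ℝ) :
    cutNorm (W - V) (f - g) = cutNorm (V - W) (g - f) := by
  have h1 (U S : Set I) : |∫ p in U ×ˢ S, (W - V) p| = |∫ p in U ×ˢ S, (V - W) p| := by
    rw [← abs_neg, ← integral_neg]; simp
  have h2 (S : Set I) : |∫ p in S, (f - g) p| = |∫ p in S, (g - f) p| := by
    rw [← abs_neg, ← integral_neg]; simp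
  simp only [cutNorm, kernelCutNorm, signalCutNorm, h1, h2]

theorem cutNorm_add_le {W V : I × I → ℝ} {f g : I → ℝ} (hW : Integrable W) (hV : Integrable V)
    (hf : Integrable f) (hg : Integrable g) :
    cutNorm (W + V) (f + g) ≤ cutNorm W f + cutNorm V g := by
  have h1 : kernelCutNorm (W + V) ≤ kernelCutNorm W + kernelCutNorm V :=
    kernelCutNorm_le fun U S hU hS => by
      have : ∫ p in U ×ˢ S, (W + V) p = (∫ p in U ×ˢ S, W p) + ∫ p in U ×ˢ S, V p :=
        integral_add hW.integrableOn hV.integrableOn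
      rw [this]
      exact (abs_add_le _ _).trans
        (add_le_add (le_kernelCutNorm hW hU hS) (le_kernelCutNorm hV hU hS))
  have h2 : signalCutNorm (f + g) ≤ signalCutNorm f + signalCutNorm g :=
    signalCutNorm_le fun S hS => by
      have : ∫ p in S, (f + g) p = (∫ p in S, f p) + ∫ p in S, g p :=
        integral_add hf.integrableOn hg.integrableOn
      rw [this]
      exact (abs_add_le _ _).trans
        (add_le_add (le_signalCutNorm hf hS) (le_signalCutNorm hg hS))
  unfold cutNorm; linarith

theorem integrable_kernelPull (φ : CoNullBijection) {W : I × I → ℝ} (hW : Integrable W) :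
    Integrable (kernelPull φ W) :=
  ((measurePreserving_prod φ).integrable_comp_of_integrable hW).congr (kernelPull_ae φ W).symm

theorem integrable_signalPull (φ : CoNullBijection) {f : I → ℝ} (hf : Integrable f) :
    Integrable (signalPull φ f) :=
  (φ.measurePreserving_ext.integrable_comp_of_integrable hf).congr (signalPull_ae φ f).symm

theorem setIntegral_comp {α : Type*} [MeasurableSpace α] {μ : Measure α} {T : α → α}
    (hT : MeasurePreserving T μ μ) {f : α → ℝ} (hf : Integrable f μ) {s : Set α}
    (hs : MeasurableSet s) : ∫ x in T ⁻¹' s, f (T x) ∂μ = ∫ x in s, f x ∂μ := by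
  have h := hT.restrict_preimage hs
  rw [← integral_map (μ := μ.restrict (T ⁻¹' s)) (f := f) hT.measurable.aemeasurable
    (by rw [h.map_eq]; exact hf.aestronglyMeasurable.restrict), h.map_eq]

theorem cutNorm_le_pull (φ : CoNullBijection) {W : I × I → ℝ} {f : I → ℝ} (hW : Integrable W)
    (hf : Integrable f) : cutNorm W f ≤ cutNorm (kernelPull φ W) (signalPull φ f) := by
  rw [cutNorm_congr (kernelPull_ae φ W) (signalPull_ae φ f)]
  refine add_le_add ?_ ?_
  · refine kernelCutNorm_le fun U S hU hS => ?_
    rw [← setIntegral_comp (measurePreserving_prod φ) hW (hU.prod hS)]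
    exact le_kernelCutNorm (U := φ.ext ⁻¹' U) (S := φ.ext ⁻¹' S)
      ((measurePreserving_prod φ).integrable_comp_of_integrable hW)
      (φ.measurable_ext hU) (φ.measurable_ext hS)
  · refine signalCutNorm_le fun S hS => ?_
    rw [← setIntegral_comp φ.measurePreserving_ext hf hS]
    exact le_signalCutNorm (φ.measurePreserving_ext.integrable_comp_of_integrable hf)
      (φ.measurable_ext hS)

theorem kernelPull_sub (φ : CoNullBijection) (W V : I × I → ℝ) :
    kernelPull φ (W - V) = kernelPull φ W - kernelPull φ V :=
  indicator_sub _ (fun p : I × I => W (φ.toFun p.1, φ.toFun p.2))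
    fun p : I × I => V (φ.toFun p.1, φ.toFun p.2)

theorem signalPull_sub (φ : CoNullBijection) (f g : I → ℝ) :
    signalPull φ (f - g) = signalPull φ f - signalPull φ g :=
  indicator_sub _ (fun p => f (φ.toFun p)) fun p => g (φ.toFun p)

theorem kernelPull_trans (φ ψ : CoNullBijection) (W : I × I → ℝ) :
    kernelPull (φ.trans ψ) W = kernelPull φ (kernelPull ψ W) := by
  classical
  funext p
  have h (x : I) : x ∈ (φ.trans ψ).source ↔ x ∈ φ.source ∧ φ.toFun x ∈ ψ.source := Iff.rfl
  have h' (x : I) : (φ.trans ψ).toFun x = ψ.toFun (φ.toFun x) := rfl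
  simp only [kernelPull, indicator_apply, mem_prod, h, h']
  split_ifs <;> first | rfl | tauto

theorem signalPull_trans (φ ψ : CoNullBijection) (f : I → ℝ) :
    signalPull (φ.trans ψ) f = signalPull φ (signalPull ψ f) := by
  classical
  funext p
  have h (x : I) : x ∈ (φ.trans ψ).source ↔ x ∈ φ.source ∧ φ.toFun x ∈ ψ.source := Iff.rfl
  have h' (x : I) : (φ.trans ψ).toFun x = ψ.toFun (φ.toFun x) := rfl
  simp only [signalPull, indicator_apply, h, h']
  split_ifs <;> first | rfl | tauto

theorem CoNullBijection.symm_apply (φ : CoNullBijection) {x : I} (hx : x ∈ φ.source) :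
    φ.toFun x ∈ φ.symm.source ∧ φ.symm.toFun (φ.toFun x) = x :=
  ⟨φ.toPartialEquiv.map_source hx, φ.toPartialEquiv.left_inv hx⟩

theorem kernelPull_symm (φ : CoNullBijection) (W : I × I → ℝ) :
    kernelPull φ (kernelPull φ.symm W) =ᵐ[volume] W := by
  filter_upwards [ae_prod_of_ae φ.ae_mem_source] with p hp
  simp [kernelPull, hp.1, hp.2, (φ.symm_apply hp.1).1, (φ.symm_apply hp.2).1,
    (φ.symm_apply hp.1).2, (φ.symm_apply hp.2).2]

theorem signalPull_symm (φ : CoNullBijection) (f : I → ℝ) :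
    signalPull φ (signalPull φ.symm f) =ᵐ[volume] f := by
  filter_upwards [φ.ae_mem_source] with p hp
  simp [signalPull, hp, (φ.symm_apply hp).1, (φ.symm_apply hp).2]

theorem cutNorm_pull (φ : CoNullBijection) {W : I × I → ℝ} {f : I → ℝ} (hW : Integrable W)
    (hf : Integrable f) : cutNorm (kernelPull φ W) (signalPull φ f) = cutNorm W f := by
  refine le_antisymm ?_ (cutNorm_le_pull φ hW hf)
  refine (cutNorm_le_pull φ.symm (integrable_kernelPull φ hW)
    (integrable_signalPull φ hf)).trans_eq ?_
  exact cutNorm_congr (kernelPull_symm φ.symm W) (signalPull_symm φ.symm f)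

theorem Graphon.integrable (W : Graphon) : Integrable W.toFun := by
  refine Integrable.of_bound W.measurable.aestronglyMeasurable 1
    (Filter.Eventually.of_forall fun p => ?_)
  rw [Real.norm_eq_abs, abs_of_nonneg (W.mem_Icc p).1]
  exact (W.mem_Icc p).2

theorem Signal.integrable {r : ℝ} (f : Signal r) : Integrable f.toFun :=
  Integrable.of_bound f.measurable.aestronglyMeasurable r (Filter.Eventually.of_forall f.abs_le)

section Distance

variable {r : ℝ}

theorem cutDistance_le (a b : GraphonSignal r) (φ : CoNullBijection) :
    cutDistance a b ≤ cutNorm (a.graphon.toFun - kernelPull φ b.graphon.toFun)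
      (a.signal.toFun - signalPull φ b.signal.toFun) := by
  refine csInf_le ⟨0, ?_⟩ ⟨φ, rfl⟩
  rintro _ ⟨ψ, rfl⟩
  exact cutNorm_nonneg _ _

theorem le_cutDistance {a b : GraphonSignal r} {t : ℝ}
    (h : ∀ φ : CoNullBijection, t ≤ cutNorm (a.graphon.toFun - kernelPull φ b.graphon.toFun)
      (a.signal.toFun - signalPull φ b.signal.toFun)) : t ≤ cutDistance a b := by
  refine le_csInf ⟨_, CoNullBijection.refl, rfl⟩ ?_
  rintro _ ⟨φ, rfl⟩
  exact h φ

theorem cutDistance_self (a : GraphonSignal r) : cutDistance a a = 0 := by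
  refine le_antisymm ((cutDistance_le a a CoNullBijection.refl).trans_eq ?_)
    (le_cutDistance fun _ => cutNorm_nonneg _ _)
  have h1 : kernelPull CoNullBijection.refl a.graphon.toFun = a.graphon.toFun := by
    funext p; exact indicator_of_mem (show p ∈ univ ×ˢ univ by simp) _
  have h2 : signalPull CoNullBijection.refl a.signal.toFun = a.signal.toFun := by
    funext p; exact indicator_of_mem (mem_univ p) _
  rw [h1, h2, sub_self, sub_self, cutNorm_zero]

theorem cutDistance_comm_le (a b : GraphonSignal r) : cutDistance a b ≤ cutDistance b a := by
  refine le_cutDistance fun φ => ?_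
  refine (cutDistance_le a b φ.symm).trans ?_
  have hW := a.graphon.integrable.sub (integrable_kernelPull φ.symm b.graphon.integrable)
  have hf := a.signal.integrable.sub (integrable_signalPull φ.symm b.signal.integrable)
  rw [← cutNorm_pull φ hW hf, kernelPull_sub, signalPull_sub, cutNorm_sub_comm]
  exact (cutNorm_congr ((kernelPull_symm φ _).sub (Filter.EventuallyEq.refl _ _))
    ((signalPull_symm φ _).sub (Filter.EventuallyEq.refl _ _))).le

theorem cutDistance_triangle (a b c : GraphonSignal r) :
    cutDistance a c ≤ cutDistance a b + cutDistance b c := by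
  rw [← sub_le_iff_le_add]
  refine le_cutDistance fun φ => ?_
  rw [sub_le_iff_le_add, ← sub_le_iff_le_add']
  refine le_cutDistance fun ψ => ?_
  rw [sub_le_iff_le_add']
  refine (cutDistance_le a c (φ.trans ψ)).trans ?_
  have hW := b.graphon.integrable.sub (integrable_kernelPull ψ c.graphon.integrable)
  have hf := b.signal.integrable.sub (integrable_signalPull ψ c.signal.integrable)
  rw [← cutNorm_pull φ hW hf]
  refine le_trans (le_of_eq ?_) (cutNorm_add_le
    (a.graphon.integrable.sub (integrable_kernelPull φ b.graphon.integrable))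
    (integrable_kernelPull φ hW)
    (a.signal.integrable.sub (integrable_signalPull φ b.signal.integrable))
    (integrable_signalPull φ hf))
  rw [kernelPull_sub, signalPull_sub, kernelPull_trans, signalPull_trans, sub_add_sub_cancel,
    sub_add_sub_cancel]

end Distance

/-- The cut distance as a pseudometric on graphon-signals. -/
instance (r : ℝ) : PseudoMetricSpace (GraphonSignal r) where
  dist := cutDistance
  dist_self := cutDistance_self
  dist_comm a b := le_antisymm (cutDistance_comm_le a b) (cutDistance_comm_le b a)
  dist_triangle := cutDistance_triangle

/-- The metric space of graphon-signals modulo zero cut distance: the quotient of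
`GraphonSignal r` by the relation `dist a b = 0`, with the induced metric. -/
abbrev QuotientSpace (r : ℝ) : Type := SeparationQuotient (GraphonSignal r)

end GraphonSignalSpace

end

/-!
A graphon `W` has `‖W - 1 / 2‖₂² ≤ 1 / 4`. Subtracting `± 1 / (2 * √n)` on a rectangle that shows
the cut norm of the remainder to exceed `1 / (2 * √n)` lowers its energy by at least `1 / (4 * n)`,
so after `n` steps the cut norm of the remainder is at most `1 / (2 * √n)`. With the signal rounded
to `n + 1` levels, every graphon-signal is thus close to a step function on `(n + 1) * 4 ^ n` cells
whose values are determined by `n` signs. Up to rearrangement only the measures of the cells matter: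
if two step functions have the same signs, and the cumulative measures of their cells agree up to
rounding, then rearrangements that sort `[0,1]` by cell match them outside a small set. Hence the
number of codes made of signs and rounded cumulative measures, at most
`2 ^ (n + (4 * n + 1) * (n + 1) * 4 ^ n)`, bounds the covering number at scale `1 / √n + O(1 / n)`,
and `k ≥ 2 ^ (c / ε ^ 2)` with `c > 1` is enough.

For completeness, a fast Cauchy sequence can be rearranged term by term so that consecutive terms
are close in the cut norm itself; then the integrals over rectangles converge, uniformly, to those
of a weak limit in `L²`.
-/

noncomputable section

namespace GraphonSignalSpace

/-! ### Rearrangements of the unit interval -/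

section Cdf

open ProbabilityTheory Filter

variable (ν : Measure ℝ)

/-- The cumulative distribution function of `ν` as a map into the unit interval. For an atomless
`ν` it transports `ν` to Lebesgue measure. -/
def cdfUnit (z : ℝ) : I := ⟨cdf ν z, cdf_nonneg ν z, cdf_le_one ν z⟩

theorem monotone_cdfUnit : Monotone (cdfUnit ν) := fun _ _ h => monotone_cdf ν h

variable [IsProbabilityMeasure ν] [NullSingletonClass ν]

theorem continuous_cdf : Continuous (cdf ν) := by
  refine continuous_iff_continuousAt.2 fun a => ?_
  rw [(monotone_cdf ν).continuousAt_iff_leftLim_eq_rightLim, StieltjesFunction.rightLim_eq]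
  refine le_antisymm ((monotone_cdf ν).leftLim_le le_rfl) ?_
  have h : (cdf ν).measure {a} = 0 := by rw [measure_cdf]; exact measure_singleton a
  rw [StieltjesFunction.measure_singleton, ENNReal.ofReal_eq_zero] at h
  linarith

theorem exists_cdf_eq {a : ℝ} (h0 : 0 < a) (h1 : a < 1) : ∃ z, cdf ν z = a :=
  mem_range_of_exists_le_of_exists_ge (continuous_cdf ν)
    (((tendsto_cdf_atBot ν).eventually_le_const h0).exists)
    (((tendsto_cdf_atTop ν).eventually_const_le h1).exists)

theorem le_measureReal_cdf_le {a : ℝ} (h1 : a ≤ 1) : a ≤ ν.real {z | cdf ν z ≤ a} := by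
  rcases h1.eq_or_lt with rfl | h1
  · have : {z | cdf ν z ≤ 1} = univ := eq_univ_of_forall (cdf_le_one ν)
    simp [this]
  rcases le_or_gt a 0 with h0 | h0
  · exact h0.trans measureReal_nonneg
  · obtain ⟨z, hz⟩ := exists_cdf_eq ν h0 h1
    calc a = ν.real (Iic z) := by rw [← hz, cdf_eq_real]
      _ ≤ ν.real {y | cdf ν y ≤ a} := measureReal_mono fun y hy => (monotone_cdf ν hy).trans_eq hz

theorem measureReal_cdf_lt_le {a : ℝ} (h0 : 0 < a) : ν.real {z | cdf ν z < a} ≤ a := by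
  rcases le_or_gt 1 a with h1 | h1
  · exact measureReal_le_one.trans h1
  · obtain ⟨z, hz⟩ := exists_cdf_eq ν h0 h1
    calc ν.real {y | cdf ν y < a} ≤ ν.real (Iic z) :=
          measureReal_mono fun y hy => ((monotone_cdf ν).reflect_lt (hy.trans_eq hz.symm)).le
      _ = a := by rw [← cdf_eq_real, hz]

theorem measurePreserving_cdfUnit : MeasurePreserving (cdfUnit ν) ν volume := by
  have hm : Measurable (cdfUnit ν) := (monotone_cdfUnit ν).measurable
  refine ⟨hm, ?_⟩
  have : IsFiniteMeasure (ν.map (cdfUnit ν)) := Measure.isFiniteMeasure_map ν _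
  refine Measure.ext_of_Iic _ _ fun a => ?_
  have hlow : a ≤ ν.real (cdfUnit ν ⁻¹' Iic a) := le_measureReal_cdf_le ν a.2.2
  have hupp : ν.real (cdfUnit ν ⁻¹' Iic a) ≤ a := le_of_forall_gt_imp_ge_of_dense fun b hb =>
    (measureReal_mono fun y (hy : cdf ν y ≤ a) => hy.trans_lt hb).trans
      (measureReal_cdf_lt_le ν (a.2.1.trans_lt hb))
  rw [Measure.map_apply hm measurableSet_Iic, unitInterval.volume_Iic, ← ofReal_measureReal,
    hupp.antisymm hlow]

end Cdf

theorem measure_image_of_injOn_conull {α β : Type*} [MeasurableSpace α] [MeasurableSpace β]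
    {μ : Measure α} {ν : Measure β} {T : α → β} (hT : MeasurePreserving T μ ν) {A S : Set α}
    (hA : μ Aᶜ = 0) (hinj : InjOn T A) (hSA : S ⊆ A) (himg : MeasurableSet (T '' S)) :
    ν (T '' S) = μ S := by
  rw [← hT.measure_preimage himg.nullMeasurableSet]
  refine measure_congr ?_
  filter_upwards [mem_ae_iff.2 hA] with x hx
  refine propext ⟨?_, fun h => mem_image_of_mem T h⟩
  rintro ⟨y, hy, hyx⟩
  rwa [← hinj (hSA hy) hx hyx]

theorem exists_coNullBijection_of_injOn {T : I → I} (hT : MeasurePreserving T) {A : Set I}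
    (hA : MeasurableSet A) (hA0 : volume Aᶜ = 0) (hinj : InjOn T A) :
    ∃ φ : CoNullBijection, φ.toFun = T := by
  have himg {S : Set I} (hSA : S ⊆ A) (hS : MeasurableSet S) : MeasurableSet (T '' S) :=
    hS.image_of_measurable_injOn hT.measurable (hinj.mono hSA)
  have hvol {S : Set I} (hSA : S ⊆ A) (hS : MeasurableSet S) : volume (T '' S) = volume S :=
    measure_image_of_injOn_conull hT hA0 hinj hSA (himg hSA hS)
  let e := hinj.toPartialEquiv T A
  refine ⟨{ toPartialEquiv := e
            measurableSet_source := hA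
            measurableSet_target := himg subset_rfl hA
            source_conull := hA0
            target_conull := ?_
            measurable_toFun := hT.measurable.comp measurable_subtype_coe
            measurable_invFun := fun S hS => ?_
            measure_image := fun S hSA hS => hvol hSA hS }, rfl⟩
  · change volume (T '' A)ᶜ = 0
    rwa [prob_compl_eq_zero_iff (himg subset_rfl hA), hvol subset_rfl hA,
      ← prob_compl_eq_zero_iff hA]
  · have hpre : (fun y : e.target => e.invFun y) ⁻¹' S = Subtype.val ⁻¹' (T '' (A ∩ S)) := by
      have himage : T '' (A ∩ S) = e.target ∩ e.symm ⁻¹' S := e.image_source_inter_eq' S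
      rw [himage, Subtype.preimage_coe_self_inter]
      rfl
    rw [hpre]
    exact measurable_subtype_coe (himg inter_subset_left (hA.inter hS))

theorem exists_coNullBijection_eq_measureReal_le {G : I → ℝ} (hG : Measurable G)
    (hinj : Function.Injective G) :
    ∃ φ : CoNullBijection, ∀ x, (φ.toFun x : ℝ) = volume.real {y | G y ≤ G x} := by
  let ν : Measure ℝ := volume.map G
  have : IsProbabilityMeasure ν := Measure.isProbabilityMeasure_map hG.aemeasurable
  have : NullSingletonClass ν := ⟨fun z => by
    rw [Measure.map_apply hG (measurableSet_singleton z)]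
    exact (subsingleton_singleton.preimage hinj).measure_zero _⟩
  let T : I → I := cdfUnit ν ∘ G
  have hT : MeasurePreserving T := (measurePreserving_cdfUnit ν).comp ⟨hG, rfl⟩
  -- `T` identifies two points only if the cdf is constant between their `G`-values, and then its
  -- value there is attained at a rational.
  let A : Set I := (⋃ a : ℚ, T ⁻¹' {cdfUnit ν a})ᶜ
  have hA : MeasurableSet A :=
    (MeasurableSet.iUnion fun a => hT.measurable (measurableSet_singleton _)).compl
  have hA0 : volume Aᶜ = 0 := by
    rw [compl_compl]
    refine measure_iUnion_null fun a => ?_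
    rw [hT.measure_preimage (measurableSet_singleton _).nullMeasurableSet, measure_singleton]
  have hnot_lt {x y : I} (hx : x ∈ A) (h : T x = T y) : ¬ G x < G y := fun hlt => by
    obtain ⟨a, hxa, hay⟩ := exists_rat_btwn hlt
    refine hx (mem_iUnion.2 ⟨a, le_antisymm (monotone_cdfUnit ν hxa.le) ?_⟩)
    rw [h]
    exact monotone_cdfUnit ν hay.le
  have hTinj : InjOn T A := fun x hx y hy h =>
    hinj (le_antisymm (not_lt.1 (hnot_lt hy h.symm)) (not_lt.1 (hnot_lt hx h)))
  obtain ⟨φ, hφ⟩ := exists_coNullBijection_of_injOn hT hA hA0 hTinj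
  refine ⟨φ, fun x => ?_⟩
  rw [hφ]
  change ProbabilityTheory.cdf ν (G x) = _
  rw [ProbabilityTheory.cdf_eq_real, map_measureReal_apply hG measurableSet_Iic]
  rfl

section Matching

variable {m : ℕ} {p q : I → Fin m}

/-- The cumulative measure of the first parts of a partition of `[0,1]`, encoded as the map `p`
that sends a point to the index of its part. -/
def cumulative (p : I → Fin m) (i : Fin m) : I :=
  ⟨volume.real {x | p x ≤ i}, measureReal_nonneg, measureReal_le_one⟩

/-- A co-null bijection that sorts `[0,1]` by the values of `p`: it sends each part of `p` into
the interval between the two cumulative measures surrounding it. -/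
structure IsSorting (φ : CoNullBijection) (p : I → Fin m) : Prop where
  le_cumulative : ∀ {x i}, p x ≤ i → φ.toFun x ≤ cumulative p i
  cumulative_le : ∀ {x i}, i < p x → cumulative p i ≤ φ.toFun x

theorem exists_isSorting (hp : Measurable p) : ∃ φ : CoNullBijection, IsSorting φ p := by
  -- Sort by `p`, breaking ties by position: this needs an injective key.
  let G : I → ℝ := fun x => ((p x : ℕ) : ℝ) + (x : ℝ) / 2
  have hlt {x y : I} (h : p x < p y) : G x < G y := by
    have h1 : ((p x : ℕ) : ℝ) + 1 ≤ (p y : ℕ) := by exact_mod_cast h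
    have := x.2.2
    have := y.2.1
    simp only [G]; linarith
  have hG : Measurable G :=
    ((measurable_from_top (f := fun i : Fin m => ((i : ℕ) : ℝ))).comp hp).add
      (measurable_subtype_coe.div_const 2)
  have hinj : Function.Injective G := by
    intro x y h
    rcases lt_trichotomy (p x) (p y) with h' | h' | h'
    · exact absurd h (hlt h').ne
    · simp only [G, h'] at h
      exact Subtype.ext (by linarith)
    · exact absurd h (hlt h').ne'
  obtain ⟨φ, hφ⟩ := exists_coNullBijection_eq_measureReal_le hG hinj
  refine ⟨φ, ⟨fun {x i} h => ?_, fun {x i} h => ?_⟩⟩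
  · refine Subtype.coe_le_coe.1 ((hφ x).trans_le (measureReal_mono fun y (hy : G y ≤ G x) => ?_))
    by_contra hyi
    exact absurd hy (not_le.2 (hlt (h.trans_lt (not_le.1 hyi))))
  · refine Subtype.coe_le_coe.1 (le_of_le_of_eq (measureReal_mono fun y hy => ?_) (hφ x).symm)
    exact (hlt (lt_of_le_of_lt hy h)).le

theorem IsSorting.exists_mem_uIcc_cumulative {α β : CoNullBijection} (hα : IsSorting α p)
    (hβ : IsSorting β q) {x y : I} (hxy : α.toFun x = β.toFun y) (hne : p x ≠ q y) :
    ∃ i, α.toFun x ∈ uIcc (cumulative p i) (cumulative q i) := by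
  rcases lt_or_gt_of_ne hne with h | h
  · exact ⟨p x, mem_uIcc.2 (Or.inr ⟨hxy ▸ hβ.cumulative_le h, hα.le_cumulative le_rfl⟩)⟩
  · exact ⟨q y, mem_uIcc.2 (Or.inl ⟨hα.cumulative_le h, hxy ▸ hβ.le_cumulative le_rfl⟩)⟩

theorem exists_measureReal_ne_comp_le (hp : Measurable p) (hq : Measurable q) :
    ∃ φ : CoNullBijection, volume.real {x | p x ≠ q (φ.ext x)} ≤
      ∑ i, dist (cumulative p i) (cumulative q i) := by
  obtain ⟨α, hα⟩ := exists_isSorting hp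
  obtain ⟨β, hβ⟩ := exists_isSorting hq
  let φ := α.trans β.symm
  let J (i : Fin m) : Set I := uIcc (cumulative p i) (cumulative q i)
  have hsub : {x | p x ≠ q (φ.ext x)} ≤ᵐ[volume] ⋃ i, α.ext ⁻¹' J i := by
    filter_upwards [φ.ae_mem_source] with x hx (hne : p x ≠ q (φ.ext x))
    have hαβ : α.toFun x = β.toFun (φ.ext x) := by
      rw [φ.ext_of_mem hx]
      exact (β.right_inv hx.2).symm
    obtain ⟨i, hi⟩ := hα.exists_mem_uIcc_cumulative hβ hαβ hne
    exact mem_iUnion.2 ⟨i, by rwa [mem_preimage, α.ext_of_mem hx.1]⟩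
  refine ⟨φ, ?_⟩
  calc volume.real {x | p x ≠ q (φ.ext x)}
      ≤ volume.real (⋃ i, α.ext ⁻¹' J i) :=
        ENNReal.toReal_mono (measure_ne_top _ _) (measure_mono_ae hsub)
    _ ≤ ∑ i, volume.real (α.ext ⁻¹' J i) := measureReal_iUnion_fintype_le _
    _ = ∑ i, dist (cumulative p i) (cumulative q i) := by
        refine Finset.sum_congr rfl fun i _ => ?_
        rw [α.measurePreserving_ext.measureReal_preimage measurableSet_uIcc.nullMeasurableSet,
          measureReal_def, unitInterval.volume_uIcc, edist_dist,
          ENNReal.toReal_ofReal dist_nonneg, dist_comm]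

/-- The cumulative measures of a partition, rounded down to multiples of `1 / M`. -/
def roundedCumulative (M : ℕ) (p : I → Fin m) (i : Fin m) : Fin (M + 1) :=
  ⟨⌊(cumulative p i : ℝ) * M⌋₊, Nat.lt_succ_of_le <| Nat.floor_le_of_le <|
    mul_le_of_le_one_left M.cast_nonneg (cumulative p i).2.2⟩

theorem dist_cumulative_le_of_roundedCumulative_eq {M : ℕ} (hM : 0 < M)
    (h : roundedCumulative M p = roundedCumulative M q) (i : Fin m) :
    dist (cumulative p i) (cumulative q i) ≤ 1 / M := by
  have hM' : (0 : ℝ) < M := Nat.cast_pos.2 hM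
  have hfloor : ⌊(cumulative p i : ℝ) * M⌋₊ = ⌊(cumulative q i : ℝ) * M⌋₊ :=
    congrArg Fin.val (congrFun h i)
  have hlow := Nat.floor_le (mul_nonneg (cumulative p i).2.1 hM'.le)
  have hupp := Nat.lt_floor_add_one ((cumulative p i : ℝ) * M)
  have hlow' := Nat.floor_le (mul_nonneg (cumulative q i).2.1 hM'.le)
  have hupp' := Nat.lt_floor_add_one ((cumulative q i : ℝ) * M)
  rw [hfloor] at hlow hupp
  rw [Subtype.dist_eq, Real.dist_eq, le_div_iff₀ hM', ← abs_of_pos hM', ← abs_mul, abs_le,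
    sub_mul]
  constructor <;> linarith

theorem exists_measureReal_ne_comp_le_of_roundedCumulative_eq {M : ℕ} (hM : 0 < M)
    (hp : Measurable p) (hq : Measurable q)
    (h : roundedCumulative M p = roundedCumulative M q) :
    ∃ φ : CoNullBijection, volume.real {x | p x ≠ q (φ.ext x)} ≤ m / M := by
  obtain ⟨φ, hφ⟩ := exists_measureReal_ne_comp_le hp hq
  refine ⟨φ, hφ.trans ((Finset.sum_le_card_nsmul _ _ _ fun i _ =>
    dist_cumulative_le_of_roundedCumulative_eq hM h i).trans_eq ?_)⟩
  rw [Finset.card_fin, nsmul_eq_mul, mul_one_div]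

end Matching

/-! ### Weak regularity -/

theorem integral_sub_indicator_sq_le {α : Type*} [MeasurableSpace α] {μ : Measure α}
    [IsProbabilityMeasure μ] {f : α → ℝ} (hf : MemLp f 2 μ) {A : Set α} (hA : MeasurableSet A)
    {d : ℝ} (hd : d ^ 2 ≤ d * ∫ x in A, f x ∂μ) :
    ∫ x, (f x - A.indicator (fun _ => d) x) ^ 2 ∂μ ≤ (∫ x, f x ^ 2 ∂μ) - d ^ 2 := by
  have hexpand (x : α) : (f x - A.indicator (fun _ => d) x) ^ 2 =
      f x ^ 2 - (2 * d * A.indicator f x - A.indicator (fun _ => d ^ 2) x) := by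
    by_cases hx : x ∈ A
    · simp only [indicator_of_mem hx]; ring
    · simp only [indicator_of_notMem hx]; ring
  have hcross : Integrable (fun x => 2 * d * A.indicator f x) μ :=
    ((hf.integrable one_le_two).indicator hA).const_mul _
  have hconst : Integrable (A.indicator fun _ => d ^ 2) μ := (integrable_const _).indicator hA
  have hrest : Integrable (fun x => 2 * d * A.indicator f x - A.indicator (fun _ => d ^ 2) x) μ :=
    hcross.sub hconst
  have hvol : μ.real A * d ^ 2 ≤ d ^ 2 :=
    mul_le_of_le_one_left (sq_nonneg d) measureReal_le_one
  simp_rw [hexpand]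
  rw [integral_sub hf.integrable_sq hrest, integral_sub hcross hconst,
    integral_const_mul, integral_indicator hA, integral_indicator hA, setIntegral_const,
    smul_eq_mul]
  linarith

/-- The number `± e`, with the sign given by a Boolean. -/
def signedHeight (e : ℝ) (s : Bool) : ℝ := if s then e else -e

theorem abs_signedHeight (e : ℝ) (s : Bool) : |signedHeight e s| = |e| := by
  cases s <;> simp [signedHeight]

theorem signedHeight_sq (e : ℝ) (s : Bool) : signedHeight e s ^ 2 = e ^ 2 :=
  (sq_eq_sq_iff_abs_eq_abs _ _).2 (abs_signedHeight e s)

theorem exists_signedHeight_mul_eq_abs (e t : ℝ) : ∃ s, signedHeight e s * t = e * |t| := by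
  rcases abs_cases t with ⟨h, -⟩ | ⟨h, -⟩
  · exact ⟨true, by simp [signedHeight, h]⟩
  · exact ⟨false, by simp [signedHeight, h]⟩

/-- The step kernel `∑ i, ± e * 1_{U i × S i}`, with the signs given by `s`. -/
def rectangleSum (e : ℝ) {n : ℕ} (s : Fin n → Bool) (U S : Fin n → Set I) : I × I → ℝ :=
  ∑ i, (U i ×ˢ S i).indicator fun _ => signedHeight e (s i)

theorem rectangleSum_vecCons (e : ℝ) {n : ℕ} (s₀ : Bool) (s : Fin n → Bool) (U₀ S₀ : Set I)
    (U S : Fin n → Set I) :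
    rectangleSum e (Matrix.vecCons s₀ s) (Matrix.vecCons U₀ U) (Matrix.vecCons S₀ S) =
      ((U₀ ×ˢ S₀).indicator fun _ => signedHeight e s₀) + rectangleSum e s U S := by
  simp [rectangleSum, Fin.sum_univ_succ]

theorem rectangleSum_empty (e : ℝ) {n : ℕ} (s : Fin n → Bool) (S : Fin n → Set I) :
    rectangleSum e s (fun _ => ∅) S = 0 :=
  Finset.sum_eq_zero fun i _ => by rw [empty_prod, indicator_empty]; rfl

theorem exists_lt_abs_setIntegral_of_lt_kernelCutNorm {W : I × I → ℝ} {t : ℝ}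
    (h : t < kernelCutNorm W) :
    ∃ U S : Set I, MeasurableSet U ∧ MeasurableSet S ∧ t < |∫ p in U ×ˢ S, W p| := by
  by_contra! hle
  exact h.not_ge (kernelCutNorm_le hle)

theorem kernelCutNorm_zero_le {e : ℝ} (he : 0 ≤ e) : kernelCutNorm 0 ≤ e :=
  kernelCutNorm_le fun U S _ _ => by simpa using he

/-- Weak regularity, by energy decrement: while the cut norm exceeds `e`, subtracting `± e` on a
rectangle that witnesses this lowers `∫ W ^ 2` by at least `e ^ 2`. -/
theorem exists_kernelCutNorm_sub_rectangleSum_le {e : ℝ} (he : 0 ≤ e) (n : ℕ) {W : I × I → ℝ}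
    (hW : MemLp W 2) (hle : ∫ p, W p ^ 2 ≤ n * e ^ 2) :
    ∃ (s : Fin n → Bool) (U S : Fin n → Set I), (∀ i, MeasurableSet (U i)) ∧
      (∀ i, MeasurableSet (S i)) ∧ kernelCutNorm (W - rectangleSum e s U S) ≤ e := by
  induction n generalizing W with
  | zero =>
    have hsq : (fun p => W p ^ 2) =ᵐ[volume] 0 :=
      (integral_eq_zero_iff_of_nonneg (fun p => sq_nonneg _) hW.integrable_sq).1
        (le_antisymm (by simpa using hle) (integral_nonneg fun p => sq_nonneg _))
    have hzero : W =ᵐ[volume] 0 := hsq.mono fun p hp => sq_eq_zero_iff.1 hp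
    refine ⟨Fin.elim0, Fin.elim0, Fin.elim0, fun i => i.elim0, fun i => i.elim0, ?_⟩
    simpa [rectangleSum, kernelCutNorm_congr hzero] using kernelCutNorm_zero_le he
  | succ n ih =>
    by_cases hcut : kernelCutNorm W ≤ e
    · refine ⟨fun _ => true, fun _ => ∅, fun _ => ∅, fun _ => .empty, fun _ => .empty, ?_⟩
      rwa [rectangleSum_empty, sub_zero]
    obtain ⟨U₀, S₀, hU₀, hS₀, hlt⟩ :=
      exists_lt_abs_setIntegral_of_lt_kernelCutNorm (not_le.1 hcut)
    obtain ⟨s₀, hs₀⟩ := exists_signedHeight_mul_eq_abs e (∫ p in U₀ ×ˢ S₀, W p)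
    let V : I × I → ℝ := W - (U₀ ×ˢ S₀).indicator fun _ => signedHeight e s₀
    have hV : MemLp V 2 :=
      hW.sub (memLp_indicator_const 2 (hU₀.prod hS₀) _ (Or.inr (measure_ne_top _ _)))
    have hdecrement : ∫ p, V p ^ 2 ≤ (∫ p, W p ^ 2) - e ^ 2 := by
      rw [← signedHeight_sq e s₀]
      refine integral_sub_indicator_sq_le hW (hU₀.prod hS₀) ?_
      rw [hs₀, signedHeight_sq, sq]
      exact mul_le_mul_of_nonneg_left hlt.le he
    obtain ⟨s, U, S, hU, hS, hVcut⟩ := ih hV (by push_cast at hle; linarith)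
    refine ⟨Matrix.vecCons s₀ s, Matrix.vecCons U₀ U, Matrix.vecCons S₀ S,
      Fin.cases hU₀ hU, Fin.cases hS₀ hS, ?_⟩
    rwa [rectangleSum_vecCons, ← sub_sub]

/-! ### Step approximations and their rearrangements -/

variable {r : ℝ}

namespace GraphonSignal

/-- The graphon-signal `(W^φ, f^φ)`. The everywhere defined extension of `φ` is used, which
changes `W^φ` and `f^φ` only on null sets and keeps them a graphon and a signal. -/
def rearrange (a : GraphonSignal r) (φ : CoNullBijection) : GraphonSignal r where
  graphon :=
    { toFun := a.graphon.toFun ∘ Prod.map φ.ext φ.ext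
      measurable := a.graphon.measurable.comp (φ.measurable_ext.prodMap φ.measurable_ext)
      mem_Icc := fun _ => a.graphon.mem_Icc _
      symm := fun _ _ => a.graphon.symm _ _ }
  signal :=
    { toFun := a.signal.toFun ∘ φ.ext
      measurable := a.signal.measurable.comp φ.measurable_ext
      abs_le := fun _ => a.signal.abs_le _ }

end GraphonSignal

theorem cutNorm_comp_ext (φ : CoNullBijection) {W : I × I → ℝ} {f : I → ℝ} (hW : Integrable W)
    (hf : Integrable f) : cutNorm (W ∘ Prod.map φ.ext φ.ext) (f ∘ φ.ext) = cutNorm W f := by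
  rw [← cutNorm_pull φ hW hf, cutNorm_congr (kernelPull_ae φ W) (signalPull_ae φ f)]

/-- The cut norm of the difference of two graphon-signals, without rearrangement. -/
def cutNormDist (a b : GraphonSignal r) : ℝ :=
  cutNorm (a.graphon.toFun - b.graphon.toFun) (a.signal.toFun - b.signal.toFun)

theorem cutNormDist_rearrange (a b : GraphonSignal r) (φ : CoNullBijection) :
    cutNormDist a (b.rearrange φ) = cutNorm (a.graphon.toFun - kernelPull φ b.graphon.toFun)
      (a.signal.toFun - signalPull φ b.signal.toFun) :=
  cutNorm_congr ((Filter.EventuallyEq.refl _ _).sub (kernelPull_ae φ _).symm)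
    ((Filter.EventuallyEq.refl _ _).sub (signalPull_ae φ _).symm)

theorem dist_le_cutNormDist_rearrange (a b : GraphonSignal r) (φ : CoNullBijection) :
    dist a b ≤ cutNormDist a (b.rearrange φ) :=
  (cutDistance_le a b φ).trans_eq (cutNormDist_rearrange a b φ).symm

theorem exists_cutNormDist_rearrange_lt {a b : GraphonSignal r} {t : ℝ} (h : dist a b < t) :
    ∃ φ, cutNormDist a (b.rearrange φ) < t := by
  by_contra! hle
  exact h.not_ge (le_cutDistance fun φ => (hle φ).trans_eq (cutNormDist_rearrange a b φ))

theorem cutNormDist_self (a : GraphonSignal r) : cutNormDist a a = 0 := by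
  rw [cutNormDist, sub_self, sub_self, cutNorm_zero]

theorem dist_rearrange_self (a : GraphonSignal r) (φ : CoNullBijection) :
    dist (a.rearrange φ) a = 0 :=
  le_antisymm ((dist_le_cutNormDist_rearrange _ a φ).trans_eq (cutNormDist_self _)) dist_nonneg

theorem dist_le_cutNormDist (a b : GraphonSignal r) : dist a b ≤ cutNormDist a b := by
  refine (dist_le_cutNormDist_rearrange a b .refl).trans_eq ?_
  have hext : CoNullBijection.refl.ext = id :=
    funext fun x => CoNullBijection.refl.ext_of_mem (mem_univ x)
  simp only [cutNormDist, GraphonSignal.rearrange, hext, Prod.map_id, Function.comp_id]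

section StepApprox

variable {γ : Type*} [MeasurableSpace γ]

/-- The graphon-signal `a` is within `e` in cut norm of the pair `(H (p x, p y), h (p x))`. For
finite `γ` this is a pair of step functions on the partition encoded by `p`. -/
structure IsStepApprox (a : GraphonSignal r) (p : I → γ) (H : γ × γ → ℝ) (h : γ → ℝ) (e : ℝ) :
    Prop where
  measurable : Measurable p
  cutNorm_le : cutNorm (a.graphon.toFun - H ∘ Prod.map p p) (a.signal.toFun - h ∘ p) ≤ e

theorem integrable_comp_of_finite {α : Type*} [MeasurableSpace α] {μ : Measure α}
    [IsFiniteMeasure μ] [Finite γ] [MeasurableSingletonClass γ] (h : γ → ℝ) {p : α → γ}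
    (hp : Measurable p) : Integrable (h ∘ p) μ :=
  have : IsFiniteMeasure (μ.map p) := Measure.isFiniteMeasure_map μ p
  Integrable.of_finite.comp_measurable hp

theorem abs_setIntegral_le_integral_of_abs_le {α : Type*} [MeasurableSpace α] {μ : Measure α}
    {f g : α → ℝ} (hg : Integrable g μ) (h : ∀ x, |f x| ≤ g x) (s : Set α) :
    |∫ x in s, f x ∂μ| ≤ ∫ x, g x ∂μ :=
  (norm_integral_le_of_norm_le (f := f) hg.integrableOn (ae_of_all _ h)).trans
    (setIntegral_le_integral hg (ae_of_all _ fun x => (abs_nonneg _).trans (h x)))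

theorem integral_fst_add_snd {α : Type*} [MeasurableSpace α] {μ : Measure α}
    [IsProbabilityMeasure μ] {g : α → ℝ} (hg : Integrable g μ) :
    ∫ z : α × α, (g z.1 + g z.2) ∂μ.prod μ = 2 * ∫ x, g x ∂μ := by
  rw [integral_add (hg.comp_fst μ) (hg.comp_snd μ), integral_fun_fst, integral_fun_snd,
    probReal_univ, one_smul, two_mul]

theorem abs_sub_comp_le_indicator {α β : Type*} {p q : α → β} {h : β → ℝ} {C : ℝ}
    (hC : ∀ u, |h u| ≤ C) (x : α) :
    |h (p x) - h (q x)| ≤ {x | p x ≠ q x}.indicator (fun _ => 2 * C) x := by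
  by_cases hx : p x = q x
  · simp [hx]
  · rw [indicator_of_mem (show x ∈ {x | p x ≠ q x} from hx), two_mul]
    exact (abs_sub _ _).trans (add_le_add (hC _) (hC _))

variable [Finite γ] [MeasurableSingletonClass γ] {a b : GraphonSignal r} {p q : I → γ}
  {H : γ × γ → ℝ} {h : γ → ℝ} {e C C' : ℝ}

theorem IsStepApprox.rearrange (ha : IsStepApprox a p H h e) (φ : CoNullBijection) :
    IsStepApprox (a.rearrange φ) (p ∘ φ.ext) H h e where
  measurable := ha.measurable.comp φ.measurable_ext
  cutNorm_le := by
    have hH := integrable_comp_of_finite (μ := volume) H (ha.measurable.prodMap ha.measurable)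
    have hh := integrable_comp_of_finite (μ := volume) h ha.measurable
    refine le_of_eq_of_le ?_ ha.cutNorm_le
    exact cutNorm_comp_ext φ (a.graphon.integrable.sub hH) (a.signal.integrable.sub hh)

theorem cutNorm_step_sub_step_le (hp : Measurable p) (hq : Measurable q) (hC : ∀ u, |H u| ≤ C)
    (hC' : ∀ u, |h u| ≤ C') :
    cutNorm (H ∘ Prod.map p p - H ∘ Prod.map q q) (h ∘ p - h ∘ q) ≤
      (4 * C + 2 * C') * volume.real {x | p x ≠ q x} := by
  let N : Set I := {x | p x ≠ q x}
  have hN : MeasurableSet N := (measurableSet_eq_fun hp hq).compl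
  have hint (B : ℝ) : Integrable (N.indicator fun _ => B) := (integrable_const B).indicator hN
  have hval (B : ℝ) : ∫ x, N.indicator (fun _ => B) x = B * volume.real N := by
    rw [integral_indicator hN, setIntegral_const, smul_eq_mul, mul_comm]
  have hkernel : kernelCutNorm (H ∘ Prod.map p p - H ∘ Prod.map q q) ≤
      4 * C * volume.real N := by
    have hbound (z : I × I) : |H (p z.1, p z.2) - H (q z.1, q z.2)| ≤
        N.indicator (fun _ => 2 * C) z.1 + N.indicator (fun _ => 2 * C) z.2 :=
      calc |H (p z.1, p z.2) - H (q z.1, q z.2)|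
          ≤ |H (p z.1, p z.2) - H (q z.1, p z.2)| + |H (q z.1, p z.2) - H (q z.1, q z.2)| :=
            abs_sub_le _ _ _
        _ ≤ _ := add_le_add
            (abs_sub_comp_le_indicator (h := fun u => H (u, p z.2)) (fun u => hC _) z.1)
            (abs_sub_comp_le_indicator (h := fun u => H (q z.1, u)) (fun u => hC _) z.2)
    have hg := ((hint (2 * C)).comp_fst volume).add ((hint (2 * C)).comp_snd volume)
    refine (kernelCutNorm_le fun U S _ _ =>
      abs_setIntegral_le_integral_of_abs_le hg hbound _).trans_eq ?_
    exact (integral_fst_add_snd (hint _)).trans (by rw [hval]; ring)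
  have hsignal : signalCutNorm (h ∘ p - h ∘ q) ≤ 2 * C' * volume.real N :=
    (signalCutNorm_le fun S _ => abs_setIntegral_le_integral_of_abs_le (hint _)
      (abs_sub_comp_le_indicator hC') S).trans_eq (hval _)
  exact (add_le_add hkernel hsignal).trans_eq (by ring)

theorem IsStepApprox.cutNormDist_le (ha : IsStepApprox a p H h e) (hb : IsStepApprox b q H h e)
    (hC : ∀ u, |H u| ≤ C) (hC' : ∀ u, |h u| ≤ C') :
    cutNormDist a b ≤ 2 * e + (4 * C + 2 * C') * volume.real {x | p x ≠ q x} := by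
  have hH {p : I → γ} (hp : Measurable p) : Integrable (H ∘ Prod.map p p) :=
    integrable_comp_of_finite H (hp.prodMap hp)
  have hh {p : I → γ} (hp : Measurable p) : Integrable (h ∘ p) := integrable_comp_of_finite h hp
  have hHp := hH ha.measurable
  have hHq := hH hb.measurable
  have hhp := hh ha.measurable
  have hhq := hh hb.measurable
  have hmid := cutNorm_step_sub_step_le ha.measurable hb.measurable hC hC'
  have hlast := hb.cutNorm_le
  rw [cutNorm_sub_comm] at hlast
  calc cutNormDist a b
      = cutNorm ((a.graphon.toFun - H ∘ Prod.map p p) +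
            (H ∘ Prod.map p p - H ∘ Prod.map q q) + (H ∘ Prod.map q q - b.graphon.toFun))
          ((a.signal.toFun - h ∘ p) + (h ∘ p - h ∘ q) + (h ∘ q - b.signal.toFun)) := by
        simp only [sub_add_sub_cancel, cutNormDist]
    _ ≤ cutNorm (a.graphon.toFun - H ∘ Prod.map p p) (a.signal.toFun - h ∘ p) +
          cutNorm (H ∘ Prod.map p p - H ∘ Prod.map q q) (h ∘ p - h ∘ q) +
          cutNorm (H ∘ Prod.map q q - b.graphon.toFun) (h ∘ q - b.signal.toFun) :=
        (cutNorm_add_le ((a.graphon.integrable.sub hHp).add (hHp.sub hHq))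
          (hHq.sub b.graphon.integrable) ((a.signal.integrable.sub hhp).add (hhp.sub hhq))
          (hhq.sub b.signal.integrable)).trans <| by
        gcongr
        exact cutNorm_add_le (a.graphon.integrable.sub hHp) (hHp.sub hHq)
          (a.signal.integrable.sub hhp) (hhp.sub hhq)
    _ ≤ e + (4 * C + 2 * C') * volume.real {x | p x ≠ q x} + e :=
        add_le_add (add_le_add ha.cutNorm_le hmid) hlast
    _ = 2 * e + (4 * C + 2 * C') * volume.real {x | p x ≠ q x} := by ring

end StepApprox

/-! ### Encoding graphon-signals by finitely many codes -/

section Level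

variable {n : ℕ} {t : ℝ}

/-- The index of the interval of length `2 * r / n` in `[-r, r]` that contains `t`. -/
def level (r : ℝ) (n : ℕ) (t : ℝ) : Fin (n + 1) :=
  ⟨min ⌊(t + r) * n / (2 * r)⌋₊ n, Nat.lt_succ_of_le (min_le_right _ _)⟩

/-- The left end point of the interval of length `2 * r / n` in `[-r, r]` with index `l`. -/
def levelValue (r : ℝ) (n : ℕ) (l : Fin (n + 1)) : ℝ := 2 * r * l / n - r

theorem measurable_level : Measurable (level r n) := by
  have hfloor : Measurable fun t : ℝ => min ⌊(t + r) * n / (2 * r)⌋₊ n :=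
    (Nat.measurable_floor.comp (((measurable_id.add_const r).mul_const _).div_const _)).min
      measurable_const
  refine measurable_to_countable' fun l => ?_
  convert hfloor (measurableSet_singleton (l : ℕ)) using 1
  ext t
  simp only [mem_preimage, mem_singleton_iff, Fin.ext_iff, level]

theorem abs_levelValue_le (hr : 0 ≤ r) (l : Fin (n + 1)) : |levelValue r n l| ≤ r := by
  have h0 : 0 ≤ (l : ℝ) / n := by positivity
  have h1 : (l : ℝ) / n ≤ 1 := div_le_one_of_le₀ (by exact_mod_cast l.is_le) n.cast_nonneg
  rw [levelValue, mul_div_assoc, abs_le]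
  constructor <;> nlinarith

theorem abs_sub_levelValue_le (hr : 0 < r) (hn : 0 < n) (ht : |t| ≤ r) :
    |t - levelValue r n (level r n t)| ≤ 2 * r / n := by
  have hn' : (0 : ℝ) < n := Nat.cast_pos.2 hn
  obtain ⟨hlow, hupp⟩ := abs_le.1 ht
  let u : ℝ := (t + r) * n / (2 * r)
  have hu0 : 0 ≤ u := div_nonneg (mul_nonneg (by linarith) hn'.le) (by positivity)
  have hun : u ≤ n := by
    rw [div_le_iff₀ (by positivity), mul_comm]
    exact mul_le_mul_of_nonneg_left (by linarith) hn'.le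
  have hlevel : ((level r n t : ℕ) : ℝ) = ⌊u⌋₊ :=
    congrArg Nat.cast (min_eq_left (Nat.floor_le_of_le hun))
  have hfrac : t - levelValue r n (level r n t) = 2 * r / n * (u - ⌊u⌋₊) := by
    rw [levelValue, hlevel]
    simp only [u]
    field_simp
    ring
  rw [hfrac, abs_of_nonneg (mul_nonneg (by positivity) (sub_nonneg.2 (Nat.floor_le hu0)))]
  exact mul_le_of_le_one_right (by positivity) (by linarith [Nat.lt_floor_add_one u])

end Level

section Cell

variable {n : ℕ} {e : ℝ}

/-- The data recorded about a point of `[0,1]`: the level of the signal, and which sets `U i` and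
`S i` of a sum of `n` signed rectangles `U i × S i` contain the point. -/
abbrev Cell (n : ℕ) : Type := Fin (n + 1) × (Fin n → Bool) × (Fin n → Bool)

theorem card_cell (n : ℕ) : Fintype.card (Cell n) = (n + 1) * 4 ^ n := by
  simp only [Fintype.card_prod, Fintype.card_fin, Fintype.card_pi, Fintype.card_bool,
    Finset.prod_const, Finset.card_univ, ← mul_pow]
  norm_num

/-- The value of the step kernel `1 / 2 + ∑ i, ± e * 1_{U i × S i}` at a point of `[0,1]²` whose
two coordinates lie in the given cells. -/
def cellKernel (e : ℝ) (s : Fin n → Bool) (z : Cell n × Cell n) : ℝ :=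
  1 / 2 + ∑ i, if z.1.2.1 i ∧ z.2.2.2 i then signedHeight e (s i) else 0

theorem abs_cellKernel_le (he : 0 ≤ e) (s : Fin n → Bool) (z : Cell n × Cell n) :
    |cellKernel e s z| ≤ 1 / 2 + n * e := by
  refine (abs_add_le _ _).trans (add_le_add (by norm_num) ?_)
  refine (Finset.abs_sum_le_sum_abs _ _).trans ?_
  refine (Finset.sum_le_card_nsmul _ _ e fun i _ => ?_).trans_eq (by simp)
  split_ifs
  · rw [abs_signedHeight, abs_of_nonneg he]
  · rwa [abs_zero]

open Classical in
/-- The cell of a point `x` of `[0,1]` for a signal `f` and a sum of rectangles `U i × S i`. -/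
def cellOf (f : Signal r) (U S : Fin n → Set I) (x : I) : Cell n :=
  (level r n (f.toFun x), fun i => decide (x ∈ U i), fun i => decide (x ∈ S i))

theorem measurable_cellOf (f : Signal r) {U S : Fin n → Set I} (hU : ∀ i, MeasurableSet (U i))
    (hS : ∀ i, MeasurableSet (S i)) : Measurable (cellOf f U S) := by
  have hdecide {A : Fin n → Set I} (hA : ∀ i, MeasurableSet (A i)) :
      Measurable fun x (i : Fin n) => open Classical in decide (x ∈ A i) :=
    measurable_pi_iff.2 fun i => measurable_to_bool (by simpa [preimage] using hA i)
  exact (measurable_level.comp f.measurable).prodMk ((hdecide hU).prodMk (hdecide hS))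

theorem cellKernel_comp_cellOf (e : ℝ) (s : Fin n → Bool) (f : Signal r) (U S : Fin n → Set I) :
    cellKernel e s ∘ Prod.map (cellOf f U S) (cellOf f U S) =
      (fun _ => 1 / 2) + rectangleSum e s U S := by
  classical
  funext z
  simp [cellKernel, cellOf, rectangleSum, indicator]

theorem Graphon.exists_kernelCutNorm_sub_rectangleSum_le (W : Graphon) (he : 0 ≤ e)
    (hn : 1 / 4 ≤ n * e ^ 2) :
    ∃ (s : Fin n → Bool) (U S : Fin n → Set I), (∀ i, MeasurableSet (U i)) ∧
      (∀ i, MeasurableSet (S i)) ∧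
      kernelCutNorm (W.toFun - ((fun _ => 1 / 2) + rectangleSum e s U S)) ≤ e := by
  have hbound (z : I × I) : |W.toFun z - 1 / 2| ≤ 1 / 2 := by
    obtain ⟨h0, h1⟩ := W.mem_Icc z
    rw [abs_le]; constructor <;> linarith
  have hmem : MemLp (fun z => W.toFun z - 1 / 2) 2 :=
    MemLp.of_bound (W.measurable.sub_const _).aestronglyMeasurable (1 / 2) (ae_of_all _ hbound)
  have henergy : ∫ z, (W.toFun z - 1 / 2) ^ 2 ≤ n * e ^ 2 :=
    calc ∫ z, (W.toFun z - 1 / 2) ^ 2 ≤ ∫ _ : I × I, (1 / 4 : ℝ) :=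
          integral_mono hmem.integrable_sq (integrable_const _) fun z => by
            have := sq_le_sq' (abs_le.1 (hbound z)).1 (abs_le.1 (hbound z)).2
            norm_num at this ⊢
            exact this
      _ = 1 / 4 := by simp
      _ ≤ n * e ^ 2 := hn
  obtain ⟨s, U, S, hU, hS, hle⟩ :=
    GraphonSignalSpace.exists_kernelCutNorm_sub_rectangleSum_le he n hmem henergy
  exact ⟨s, U, S, hU, hS, by rw [← sub_sub]; exact hle⟩

theorem exists_isStepApprox (hr : 0 < r) (hn0 : 0 < n) (he : 0 ≤ e) (hn : 1 / 4 ≤ n * e ^ 2)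
    (a : GraphonSignal r) :
    ∃ (s : Fin n → Bool) (p : I → Cell n),
      IsStepApprox a p (cellKernel e s) (fun u => levelValue r n u.1) (e + 2 * r / n) := by
  obtain ⟨s, U, S, hU, hS, hkernel⟩ := a.graphon.exists_kernelCutNorm_sub_rectangleSum_le he hn
  have hsignal : signalCutNorm (a.signal.toFun -
      (fun u : Cell n => levelValue r n u.1) ∘ cellOf a.signal U S) ≤ 2 * r / n :=
    signalCutNorm_le fun A _ =>
      (abs_setIntegral_le_integral_of_abs_le (integrable_const (2 * r / n))
        (fun x => abs_sub_levelValue_le hr hn0 (a.signal.abs_le x)) A).trans_eq (by simp)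
  refine ⟨s, cellOf a.signal U S, measurable_cellOf _ hU hS, add_le_add ?_ hsignal⟩
  rwa [cellKernel_comp_cellOf]

end Cell

/-- Codes for graphon-signals: the signs of `n` rectangles, and the cumulative measures of the
`(n + 1) * 4 ^ n` cells rounded to multiples of `1 / 16 ^ n`. -/
abbrev Code (n : ℕ) : Type := (Fin n → Bool) × (Fin ((n + 1) * 4 ^ n) → Fin (16 ^ n + 1))

/-- An upper bound for the number of binary digits needed to write down a code in `Code n`. -/
def codeBits (n : ℕ) : ℕ := n + (4 * n + 1) * ((n + 1) * 4 ^ n)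

theorem card_code_le (n : ℕ) : Fintype.card (Code n) ≤ 2 ^ codeBits n := by
  have hbase : 16 ^ n + 1 ≤ 2 ^ (4 * n + 1) := by
    rw [pow_succ, pow_mul]
    have := Nat.one_le_pow n 16 (by norm_num)
    norm_num only
    omega
  simp only [Fintype.card_prod, Fintype.card_pi, Fintype.card_bool, Fintype.card_fin,
    Finset.prod_const, Finset.card_univ]
  rw [codeBits, pow_add, pow_mul 2 (4 * n + 1)]
  exact Nat.mul_le_mul_left _ (Nat.pow_le_pow_left hbase _)

/-- A bound for the distance of two graphon-signals with the same code in `Code n`: twice the error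
`1 / (2 * √n) + 2 * r / n` of the step approximation, and the error from matching the cells. -/
def codeError (r : ℝ) (n : ℕ) : ℝ :=
  2 * (1 / (2 * √n) + 2 * r / n) + (2 + 2 * √n + 2 * r) * ((n + 1) / 4 ^ n)

theorem exists_code (hr : 0 < r) {n : ℕ} (hn : 0 < n) :
    ∃ code : GraphonSignal r → Code n, ∀ a b, code a = code b → dist a b ≤ codeError r n := by
  have hn' : (0 : ℝ) < n := Nat.cast_pos.2 hn
  have hsq : √(n : ℝ) ^ 2 = n := Real.sq_sqrt hn'.le
  let e : ℝ := 1 / (2 * √n)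
  have he : 0 ≤ e := by positivity
  have hne : n * e = √n / 2 := by simp only [e]; field_simp; rw [hsq]
  have hne2 : n * e ^ 2 = 1 / 4 := by simp only [e]; field_simp; rw [hsq]; ring
  choose s p happrox using exists_isStepApprox hr hn he hne2.ge
  let E : Cell n ≃ Fin ((n + 1) * 4 ^ n) := Fintype.equivFinOfCardEq (card_cell n)
  have hE (a : GraphonSignal r) : Measurable (E ∘ p a) :=
    (measurable_of_finite E).comp (happrox a).measurable
  refine ⟨fun a => (s a, roundedCumulative (16 ^ n) (E ∘ p a)), fun a b hab => ?_⟩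
  obtain ⟨hs, hrounded⟩ : s a = s b ∧ _ := Prod.ext_iff.1 hab
  obtain ⟨φ, hφ⟩ := exists_measureReal_ne_comp_le_of_roundedCumulative_eq (by positivity)
    (hE a) (hE b) hrounded
  simp only [Function.comp_apply, ne_eq, E.injective.eq_iff] at hφ
  calc dist a b ≤ cutNormDist a (b.rearrange φ) := dist_le_cutNormDist_rearrange a b φ
    _ ≤ 2 * (e + 2 * r / n) + (4 * (1 / 2 + n * e) + 2 * r) *
          volume.real {x | p a x ≠ p b (φ.ext x)} :=
        (happrox a).cutNormDist_le (hs ▸ (happrox b).rearrange φ) (abs_cellKernel_le he _)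
          fun u => abs_levelValue_le hr.le u.1
    _ ≤ 2 * (e + 2 * r / n) + (4 * (1 / 2 + n * e) + 2 * r) *
          (((n + 1) * 4 ^ n : ℕ) / (16 ^ n : ℕ)) := by gcongr
    _ = codeError r n := by
        rw [hne, codeError, show (16 : ℕ) = 4 * 4 by norm_num, mul_pow]
        push_cast
        simp only [e]
        field_simp
        ring

theorem exists_cover_of_code {X C : Type*} [PseudoMetricSpace X] [Nonempty X] [Fintype C]
    {ε : ℝ} (code : X → C) (h : ∀ a b, code a = code b → dist a b < ε) {N : ℕ}
    (hN : Fintype.card C ≤ N) :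
    ∃ center : Fin N → SeparationQuotient X, (⋃ i, Metric.ball (center i) ε) = univ := by
  obtain ⟨g⟩ : Nonempty (C ↪ Fin N) :=
    Function.Embedding.nonempty_of_card_le (by rwa [Fintype.card_fin])
  refine ⟨fun i => SeparationQuotient.mk (Function.invFun (g ∘ code) i), eq_univ_of_forall ?_⟩
  intro y
  obtain ⟨x, rfl⟩ := SeparationQuotient.surjective_mk y
  refine mem_iUnion.2 ⟨g (code x), ?_⟩
  rw [Metric.mem_ball, SeparationQuotient.dist_mk]
  have hrepr : (g ∘ code) (Function.invFun (g ∘ code) (g (code x))) = g (code x) :=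
    Function.invFun_eq ⟨x, rfl⟩
  exact h _ _ (g.injective hrepr).symm

theorem nonempty_graphonSignal (hr : 0 ≤ r) : Nonempty (GraphonSignal r) :=
  ⟨{ graphon := ⟨0, measurable_zero, fun _ => ⟨le_rfl, zero_le_one⟩, fun _ _ => rfl⟩
     signal := ⟨0, measurable_zero, fun _ => by simpa using hr⟩ }⟩

theorem exists_cover_of_codeError_lt (hr : 0 < r) {n N : ℕ} (hn : 0 < n) {ε : ℝ}
    (hε : codeError r n < ε) (hN : 2 ^ codeBits n ≤ N) :
    ∃ center : Fin N → QuotientSpace r, (⋃ i, Metric.ball (center i) ε) = univ := by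
  have := nonempty_graphonSignal hr.le
  obtain ⟨code, hcode⟩ := exists_code hr hn
  exact exists_cover_of_code code (fun a b hab => (hcode a b hab).trans_lt hε)
    ((card_code_le n).trans hN)

/-! ### Asymptotics of the number of codes -/

open Filter Topology

theorem tendsto_inv_sqrt_natCast : Tendsto (fun n : ℕ => (√(n : ℝ))⁻¹) atTop (𝓝 0) :=
  tendsto_inv_atTop_zero.comp (Real.tendsto_sqrt_atTop.comp tendsto_natCast_atTop_atTop)

theorem tendsto_sqrt_mul_codeError (r : ℝ) :
    Tendsto (fun n : ℕ => √n * codeError r n) atTop (𝓝 1) := by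
  have hpow : Tendsto (fun n : ℕ => (n : ℝ) ^ 2 / 4 ^ n + (n : ℝ) ^ 1 / 4 ^ n) atTop (𝓝 0) := by
    simpa only [add_zero] using
      (tendsto_pow_const_div_const_pow_of_one_lt 2 (r := (4 : ℝ)) (by norm_num)).add
        (tendsto_pow_const_div_const_pow_of_one_lt 1 (by norm_num))
  have hlim : Tendsto (fun n : ℕ => 1 + 4 * r * (√(n : ℝ))⁻¹ +
      ((2 + 2 * r) * (√(n : ℝ))⁻¹ + 2) * ((n : ℝ) ^ 2 / 4 ^ n + (n : ℝ) ^ 1 / 4 ^ n))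
      atTop (𝓝 (1 + 4 * r * 0 + ((2 + 2 * r) * 0 + 2) * 0)) :=
    ((tendsto_inv_sqrt_natCast.const_mul _).const_add _).add
      (((tendsto_inv_sqrt_natCast.const_mul _).add_const _).mul hpow)
  simp only [mul_zero, add_zero] at hlim
  refine hlim.congr' ((eventually_gt_atTop 0).mono fun n hn => ?_)
  have hs : 0 < √(n : ℝ) := Real.sqrt_pos.2 (Nat.cast_pos.2 hn)
  have hsq : √(n : ℝ) ^ 2 = n := Real.sq_sqrt n.cast_nonneg
  simp only [codeError]
  generalize √(n : ℝ) = s at hs hsq ⊢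
  rw [← hsq]
  field_simp
  ring

theorem tendsto_codeError (r : ℝ) : Tendsto (codeError r) atTop (𝓝 0) := by
  have hmul := tendsto_inv_sqrt_natCast.mul (tendsto_sqrt_mul_codeError r)
  rw [zero_mul] at hmul
  refine hmul.congr' ((eventually_gt_atTop 0).mono fun n hn => ?_)
  exact inv_mul_cancel_left₀ (Real.sqrt_pos.2 (Nat.cast_pos.2 hn)).ne' _

theorem eventually_codeBits_le {d : ℝ} (hd : 1 < d) :
    ∀ᶠ n : ℕ in atTop, (codeBits n : ℝ) ≤ 4 ^ (d * (n - 1)) := by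
  have hbase : (1 : ℝ) < 4 ^ (d - 1) := Real.one_lt_rpow (by norm_num) (by linarith)
  have hsmall : ∀ᶠ n : ℕ in atTop, (n : ℝ) ^ 2 / (4 ^ (d - 1)) ^ n < 1 / (11 * 4 ^ d) :=
    (tendsto_pow_const_div_const_pow_of_one_lt 2 hbase).eventually_lt_const (by positivity)
  filter_upwards [hsmall, eventually_ge_atTop 1] with n hsmall hn
  have hn' : (1 : ℝ) ≤ n := by exact_mod_cast hn
  have h4 : (1 : ℝ) ≤ 4 ^ n := one_le_pow₀ (by norm_num)
  rw [div_lt_div_iff₀ (by positivity) (by positivity), one_mul] at hsmall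
  have hexp : (4 : ℝ) ^ (d * (n - 1)) * 4 ^ d = 4 ^ n * (4 ^ (d - 1)) ^ n := by
    rw [← Real.rpow_natCast, ← Real.rpow_natCast, ← Real.rpow_mul (by norm_num),
      ← Real.rpow_add (by norm_num), ← Real.rpow_add (by norm_num)]
    congr 1
    ring
  have hbits : (n + (4 * n + 1) * ((n + 1) * 4 ^ n) : ℝ) ≤ 11 * n ^ 2 * 4 ^ n := by
    have h1 : (n : ℝ) ≤ n ^ 2 * 4 ^ n := by nlinarith [mul_le_mul hn' h4 zero_le_one (by linarith)]
    nlinarith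
  rw [codeBits]
  push_cast
  refine le_of_mul_le_mul_right (a := (4 : ℝ) ^ d) ?_ (by positivity)
  calc (n + (4 * n + 1) * ((n + 1) * 4 ^ n)) * (4 : ℝ) ^ d
      ≤ 11 * n ^ 2 * 4 ^ n * 4 ^ d := by gcongr
    _ = 4 ^ n * (n ^ 2 * (11 * 4 ^ d)) := by ring
    _ ≤ 4 ^ n * (4 ^ (d - 1)) ^ n := by gcongr
    _ = 4 ^ (d * (n - 1)) * 4 ^ d := hexp.symm

/-- For small `ε` take `n = ⌈√c / ε ^ 2⌉`: one factor `√c` of the room left by `c > 1` absorbs the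
lower order terms of `codeError`, the other one those of the number of codes. -/
theorem eventually_exists_codeError_lt (r : ℝ) {c : ℝ} (hc : 1 < c) :
    ∀ᶠ ε : ℝ in 𝓝[>] 0, ∃ n : ℕ, 0 < n ∧ codeError r n < ε ∧
      (codeBits n : ℝ) ≤ 4 ^ (c / ε ^ 2) := by
  have hd : 1 < √c := Real.lt_sqrt_of_sq_lt (by linarith)
  have hd' : 1 < √(√c) := Real.lt_sqrt_of_sq_lt (by linarith)
  have hceil : Tendsto (fun ε : ℝ => ⌈√c / ε ^ 2⌉₊) (𝓝[>] 0) atTop := by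
    have hsq : Tendsto (fun ε : ℝ => √c * (ε⁻¹) ^ 2) (𝓝[>] 0) atTop :=
      ((tendsto_pow_atTop two_ne_zero).comp tendsto_inv_nhdsGT_zero).const_mul_atTop
        (by linarith)
    simp only [inv_pow, ← div_eq_mul_inv] at hsq
    exact tendsto_nat_ceil_atTop.comp hsq
  filter_upwards [hceil.eventually (eventually_gt_atTop 0),
    hceil.eventually ((tendsto_sqrt_mul_codeError r).eventually_lt_const hd'),
    hceil.eventually (eventually_codeBits_le hd), self_mem_nhdsWithin] with ε hpos herr hbits hε
  rw [mem_Ioi] at hε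
  have hsqrt : 0 < √(⌈√c / ε ^ 2⌉₊ : ℝ) := Real.sqrt_pos.2 (Nat.cast_pos.2 hpos)
  refine ⟨_, hpos, lt_of_mul_lt_mul_left (herr.trans_le ?_) hsqrt.le, hbits.trans ?_⟩
  · rw [← Real.sqrt_sq hε.le, ← Real.sqrt_mul (Nat.cast_nonneg _)]
    refine Real.sqrt_le_sqrt ?_
    rw [Real.sqrt_sq hε.le, ← div_le_iff₀ (by positivity)]
    exact Nat.le_ceil _
  · refine Real.rpow_le_rpow_of_exponent_le (by norm_num) ?_
    calc √c * ((⌈√c / ε ^ 2⌉₊ : ℝ) - 1) ≤ √c * (√c / ε ^ 2) := by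
          gcongr
          exact (sub_lt_iff_lt_add.2 (Nat.ceil_lt_add_one (by positivity))).le
      _ = c / ε ^ 2 := by rw [← mul_div_assoc, Real.mul_self_sqrt (by linarith)]

theorem exists_cover_of_rpow_le (hr : 0 < r) {c : ℝ} (hc : 1 < c) :
    ∃ ε₀ : ℝ, 0 < ε₀ ∧ ∀ ε : ℝ, 0 < ε → ε < ε₀ → ∀ k : ℕ, (2 : ℝ) ^ (c / ε ^ 2) ≤ k →
      ∃ center : Fin (2 ^ k ^ 2) → QuotientSpace r, (⋃ i, Metric.ball (center i) ε) = univ := by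
  obtain ⟨ε₀, hε₀, hsub⟩ := mem_nhdsGT_iff_exists_Ioo_subset.1
    (eventually_exists_codeError_lt r hc)
  refine ⟨ε₀, hε₀, fun ε h0 h1 k hk => ?_⟩
  obtain ⟨n, hn, herr, hbits⟩ := hsub ⟨h0, h1⟩
  refine exists_cover_of_codeError_lt hr hn herr (Nat.pow_le_pow_right two_pos ?_)
  have hsq : (4 : ℝ) ^ (c / ε ^ 2) ≤ (k : ℝ) ^ 2 := by
    rw [show (4 : ℝ) = 2 ^ (2 : ℕ) by norm_num, ← Real.rpow_pow_comm zero_le_two]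
    gcongr
  exact_mod_cast hbits.trans hsq

/-! ### Completeness -/

theorem exists_tendsto_inner_of_norm_le {𝕜 H ι : Type*} [RCLike 𝕜] [NormedAddCommGroup H]
    [InnerProductSpace 𝕜 H] [CompleteSpace H] (𝒰 : Ultrafilter ι) {v : ι → H} {R : ℝ}
    (hv : ∀ i, ‖v i‖ ≤ R) :
    ∃ g : H, ∀ z, Tendsto (fun i => inner 𝕜 (v i) z) 𝒰 (𝓝 (inner 𝕜 g z)) := by
  let w : ι → WeakDual 𝕜 H := fun i =>
    StrongDual.toWeakDual (InnerProductSpace.toDual 𝕜 H (v i))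
  have hw (i) : w i ∈ WeakDual.toStrongDual ⁻¹' Metric.closedBall (0 : StrongDual 𝕜 H) R := by
    change InnerProductSpace.toDual 𝕜 H (v i) ∈ Metric.closedBall 0 R
    rw [mem_closedBall_zero_iff, LinearIsometryEquiv.norm_map]
    exact hv i
  obtain ⟨ℓ, -, hℓ⟩ := (WeakDual.isCompact_closedBall (𝕜 := 𝕜) 0 R).ultrafilter_le_nhds (𝒰.map w)
    (tendsto_principal.2 (Eventually.of_forall hw))
  obtain ⟨g, hg⟩ := (InnerProductSpace.toDual 𝕜 H).surjective (WeakDual.toStrongDual ℓ)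
  refine ⟨g, fun z => ?_⟩
  have hgz : inner 𝕜 g z = ℓ z := congrArg (fun f : StrongDual 𝕜 H => f z) hg
  rw [hgz]
  exact ((WeakDual.eval_continuous z).tendsto ℓ).comp hℓ

section WeakLimit

variable {α ι : Type*} [MeasurableSpace α] {μ : Measure α} [IsFiniteMeasure μ]

theorem exists_integrable_tendsto_setIntegral (𝒰 : Ultrafilter ι) {F : ι → α → ℝ} {B : ℝ}
    (hF : ∀ i, AEStronglyMeasurable (F i) μ) (hB : ∀ i x, |F i x| ≤ B) :
    ∃ G : α → ℝ, Measurable G ∧ Integrable G μ ∧ ∀ A, MeasurableSet A →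
      Tendsto (fun i => ∫ x in A, F i x ∂μ) 𝒰 (𝓝 (∫ x in A, G x ∂μ)) := by
  have hmem (i) : MemLp (F i) 2 μ := MemLp.of_bound (hF i) B (ae_of_all _ (hB i))
  have hnorm (i) : ‖(hmem i).toLp‖ ≤ μ.real univ ^ (2 : ENNReal).toReal⁻¹ * |B| := by
    refine Lp.norm_le_of_ae_bound (abs_nonneg B) ?_
    filter_upwards [(hmem i).coeFn_toLp] with x hx
    rw [hx]
    exact (hB i x).trans (le_abs_self B)
  obtain ⟨g, hg⟩ := exists_tendsto_inner_of_norm_le (𝕜 := ℝ) 𝒰 hnorm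
  refine ⟨g, (Lp.stronglyMeasurable g).measurable, (Lp.memLp g).integrable one_le_two,
    fun A hA => ?_⟩
  have hinner (y : Lp ℝ 2 μ) :
      inner ℝ y (indicatorConstLp 2 hA (measure_ne_top μ A) 1) = ∫ x in A, y x ∂μ := by
    rw [real_inner_comm]
    exact L2.inner_indicatorConstLp_one hA _ y
  have hF' (i) : ∫ x in A, (hmem i).toLp (F i) x ∂μ = ∫ x in A, F i x ∂μ :=
    integral_congr_ae (ae_restrict_of_ae (hmem i).coeFn_toLp)
  simpa only [hinner, hF'] using hg (indicatorConstLp 2 hA (measure_ne_top μ A) 1)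

theorem exists_mem_Icc_tendsto_setIntegral (𝒰 : Ultrafilter ι) {l u : ℝ} (hlu : l ≤ u)
    {F : ι → α → ℝ} (hF : ∀ i, AEStronglyMeasurable (F i) μ) (hb : ∀ i x, F i x ∈ Icc l u) :
    ∃ G : α → ℝ, Measurable G ∧ (∀ x, G x ∈ Icc l u) ∧ ∀ A, MeasurableSet A →
      Tendsto (fun i => ∫ x in A, F i x ∂μ) 𝒰 (𝓝 (∫ x in A, G x ∂μ)) := by
  have hbound (i x) : |F i x| ≤ max |l| |u| := abs_le_max_abs_abs (hb i x).1 (hb i x).2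
  have hFint (i) : Integrable (F i) μ := .of_bound (hF i) _ (ae_of_all _ (hbound i))
  obtain ⟨g, hg, hgint, hlim⟩ := exists_integrable_tendsto_setIntegral 𝒰 hF hbound
  have hlg : (fun _ => l) ≤ᵐ[μ] g :=
    ae_le_of_forall_setIntegral_le (integrable_const l) hgint fun A hA _ =>
      ge_of_tendsto (hlim A hA) (Eventually.of_forall fun i =>
        setIntegral_mono (integrable_const l).integrableOn (hFint i).integrableOn
          fun x => (hb i x).1)
  have hgu : g ≤ᵐ[μ] fun _ => u :=
    ae_le_of_forall_setIntegral_le hgint (integrable_const u) fun A hA _ =>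
      le_of_tendsto (hlim A hA) (Eventually.of_forall fun i =>
        setIntegral_mono (hFint i).integrableOn (integrable_const u).integrableOn
          fun x => (hb i x).2)
  refine ⟨fun x => max l (min u (g x)), measurable_const.max (measurable_const.min hg),
    fun x => ⟨le_max_left _ _, max_le hlu (min_le_left _ _)⟩, fun A hA => ?_⟩
  have hclamp : (fun x => max l (min u (g x))) =ᵐ[μ] g := by
    filter_upwards [hlg, hgu] with x hl hu
    rw [min_eq_right hu, max_eq_right hl]
  rw [integral_congr_ae (ae_restrict_of_ae hclamp)]
  exact hlim A hA

theorem Signal.exists_tendsto_setIntegral (𝒰 : Ultrafilter ι) (f : ι → Signal r) :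
    ∃ g : Signal r, ∀ S, MeasurableSet S →
      Tendsto (fun i => ∫ x in S, (f i).toFun x) 𝒰 (𝓝 (∫ x in S, g.toFun x)) := by
  obtain ⟨i⟩ := 𝒰.neBot.nonempty
  have hr : 0 ≤ r := (abs_nonneg _).trans ((f i).abs_le 0)
  obtain ⟨g, hg, hmem, hlim⟩ := exists_mem_Icc_tendsto_setIntegral (μ := volume) 𝒰 (neg_le_self hr)
    (fun i => (f i).measurable.aestronglyMeasurable) fun i x => _root_.abs_le.1 ((f i).abs_le x)
  exact ⟨⟨g, hg, fun x => _root_.abs_le.2 (hmem x)⟩, hlim⟩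

theorem Graphon.setIntegral_prod_comm (W : Graphon) (U S : Set I) :
    ∫ z in U ×ˢ S, W.toFun z = ∫ z in S ×ˢ U, W.toFun z := by
  refine Eq.trans ?_ (setIntegral_prod_swap S U W.toFun)
  exact integral_congr_ae (ae_of_all _ fun z => W.symm _ _)

theorem Graphon.exists_tendsto_setIntegral (𝒰 : Ultrafilter ι) (W : ι → Graphon) :
    ∃ V : Graphon, ∀ U S, MeasurableSet U → MeasurableSet S →
      Tendsto (fun i => ∫ z in U ×ˢ S, (W i).toFun z) 𝒰 (𝓝 (∫ z in U ×ˢ S, V.toFun z)) := by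
  obtain ⟨G, hG, hmem, hlim⟩ := exists_mem_Icc_tendsto_setIntegral (μ := volume) 𝒰 zero_le_one
    (fun i => (W i).measurable.aestronglyMeasurable) fun i z => (W i).mem_Icc z
  let V : Graphon :=
    { toFun := fun z => (G z + G z.swap) / 2
      measurable := (hG.add (hG.comp measurable_swap)).div_const 2
      mem_Icc := fun z => by
        obtain ⟨h0, h1⟩ := hmem z
        obtain ⟨h0', h1'⟩ := hmem z.swap
        constructor <;> linarith
      symm := fun x y => by simp only [Prod.swap_prod_mk, add_comm] }
  refine ⟨V, fun U S hU hS => ?_⟩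
  have hGint : Integrable G :=
    .of_mem_Icc 0 1 hG.aemeasurable (ae_of_all _ hmem)
  have hV : ∫ z in U ×ˢ S, V.toFun z =
      ((∫ z in U ×ˢ S, G z) + ∫ z in S ×ˢ U, G z) / 2 := by
    have hswap : ∫ z in U ×ˢ S, G z.swap = ∫ z in S ×ˢ U, G z := setIntegral_prod_swap S U G
    have hGswap : Integrable fun z : I × I => G z.swap := hGint.swap
    rw [← hswap, ← integral_add hGint.integrableOn hGswap.integrableOn, ← integral_div]
  have hW (i) : ∫ z in U ×ˢ S, (W i).toFun z =
      ((∫ z in U ×ˢ S, (W i).toFun z) + ∫ z in S ×ˢ U, (W i).toFun z) / 2 := by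
    rw [(W i).setIntegral_prod_comm S U, add_self_div_two]
  rw [hV]
  refine Tendsto.congr (fun i => (hW i).symm) ?_
  exact ((hlim _ (hU.prod hS)).add (hlim _ (hS.prod hU))).div_const 2

end WeakLimit

theorem kernelCutNorm_le_cutNorm (W : I × I → ℝ) {f : I → ℝ} (hf : Integrable f) :
    kernelCutNorm W ≤ cutNorm W f :=
  le_add_of_nonneg_right ((abs_nonneg _).trans (le_signalCutNorm hf .empty))

theorem signalCutNorm_le_cutNorm {W : I × I → ℝ} (hW : Integrable W) (f : I → ℝ) :
    signalCutNorm f ≤ cutNorm W f :=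
  le_add_of_nonneg_left ((abs_nonneg _).trans (le_kernelCutNorm hW .empty .empty))

theorem dist_setIntegral_graphon_le_cutNormDist (a b : GraphonSignal r) {U S : Set I}
    (hU : MeasurableSet U) (hS : MeasurableSet S) :
    dist (∫ z in U ×ˢ S, a.graphon.toFun z) (∫ z in U ×ˢ S, b.graphon.toFun z)
      ≤ cutNormDist a b := by
  rw [Real.dist_eq,
    ← integral_sub' a.graphon.integrable.integrableOn b.graphon.integrable.integrableOn]
  exact (le_kernelCutNorm (a.graphon.integrable.sub b.graphon.integrable) hU hS).trans
    (kernelCutNorm_le_cutNorm _ (a.signal.integrable.sub b.signal.integrable))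

theorem dist_setIntegral_signal_le_cutNormDist (a b : GraphonSignal r) {S : Set I}
    (hS : MeasurableSet S) :
    dist (∫ x in S, a.signal.toFun x) (∫ x in S, b.signal.toFun x) ≤ cutNormDist a b := by
  rw [Real.dist_eq,
    ← integral_sub' a.signal.integrable.integrableOn b.signal.integrable.integrableOn]
  exact (le_signalCutNorm (a.signal.integrable.sub b.signal.integrable) hS).trans
    (signalCutNorm_le_cutNorm (a.graphon.integrable.sub b.graphon.integrable) _)

theorem dist_le_of_tendsto_hyperfilter {X : Type*} [PseudoMetricSpace X] {u : ℕ → X} {x : X}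
    {C : ℝ} (hu : ∀ n, dist (u n) (u (n + 1)) ≤ C / 2 / 2 ^ n)
    (hx : Tendsto u (hyperfilter ℕ) (𝓝 x)) (n : ℕ) : dist (u n) x ≤ C / 2 ^ n :=
  dist_le_of_le_geometric_two_of_tendsto hu
    (tendsto_nhds_of_cauchySeq_of_subseq (cauchySeq_of_le_geometric_two hu)
      Nat.hyperfilter_le_atTop hx) n

theorem exists_cutNormDist_le_of_cutNormDist_succ_le {a : ℕ → GraphonSignal r} {C : ℝ}
    (ha : ∀ n, cutNormDist (a n) (a (n + 1)) ≤ C / 2 / 2 ^ n) :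
    ∃ b, ∀ n, cutNormDist (a n) b ≤ 2 * (C / 2 ^ n) := by
  obtain ⟨V, hV⟩ := Graphon.exists_tendsto_setIntegral (hyperfilter ℕ) fun n => (a n).graphon
  obtain ⟨g, hg⟩ := Signal.exists_tendsto_setIntegral (hyperfilter ℕ) fun n => (a n).signal
  refine ⟨⟨V, g⟩, fun n => ?_⟩
  have hkernel : kernelCutNorm ((a n).graphon.toFun - V.toFun) ≤ C / 2 ^ n :=
    kernelCutNorm_le fun U S hU hS => by
      rw [integral_sub' (a n).graphon.integrable.integrableOn V.integrable.integrableOn]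
      exact dist_le_of_tendsto_hyperfilter
        (fun m => (dist_setIntegral_graphon_le_cutNormDist _ _ hU hS).trans (ha m)) (hV U S hU hS) n
  have hsignal : signalCutNorm ((a n).signal.toFun - g.toFun) ≤ C / 2 ^ n :=
    signalCutNorm_le fun S hS => by
      rw [integral_sub' (a n).signal.integrable.integrableOn g.integrable.integrableOn]
      exact dist_le_of_tendsto_hyperfilter
        (fun m => (dist_setIntegral_signal_le_cutNormDist _ _ hS).trans (ha m)) (hg S hS) n
  exact (add_le_add hkernel hsignal).trans_eq (two_mul _).symm

/-- Each term is rearranged to match the rearrangement already chosen for the previous one. -/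
theorem exists_forall_cutNormDist_succ_lt {a : ℕ → GraphonSignal r} {δ : ℕ → ℝ}
    (ha : ∀ n, dist (a n) (a (n + 1)) < δ n) :
    ∃ b : ℕ → GraphonSignal r, (∀ n, dist (a n) (b n) = 0) ∧
      ∀ n, cutNormDist (b n) (b (n + 1)) < δ n := by
  have hnext (n) (x : {x // dist (a n) x = 0}) :
      ∃ y : {y // dist (a (n + 1)) y = 0}, cutNormDist x.1 y.1 < δ n := by
    have hlt : dist x.1 (a (n + 1)) < δ n :=
      (dist_triangle_left _ _ (a n)).trans_lt (by rw [x.2, zero_add]; exact ha n)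
    obtain ⟨φ, hφ⟩ := exists_cutNormDist_rearrange_lt hlt
    exact ⟨⟨_, (dist_comm _ _).trans (dist_rearrange_self (a (n + 1)) φ)⟩, hφ⟩
  choose next hlt using hnext
  let b : ∀ n, {x // dist (a n) x = 0} := fun n => n.rec ⟨a 0, dist_self _⟩ next
  exact ⟨fun n => (b n).1, fun n => (b n).2, fun n => hlt n (b n)⟩

instance (r : ℝ) : CompleteSpace (GraphonSignal r) := by
  refine Metric.complete_of_convergent_controlled_sequences (fun n => 1 / 2 / 2 ^ n)
    (fun n => by positivity) fun a ha => ?_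
  obtain ⟨a', hdist, hsucc⟩ :=
    exists_forall_cutNormDist_succ_lt fun n => ha n n (n + 1) le_rfl n.le_succ
  obtain ⟨b, hb⟩ := exists_cutNormDist_le_of_cutNormDist_succ_le fun n => (hsucc n).le
  have hbound (n) : dist (a n) b ≤ 2 * (1 / 2 ^ n) :=
    calc dist (a n) b ≤ dist (a n) (a' n) + dist (a' n) b := dist_triangle _ _ _
      _ ≤ 0 + 2 * (1 / 2 ^ n) :=
        add_le_add (hdist n).le ((dist_le_cutNormDist _ _).trans (hb n))
      _ = 2 * (1 / 2 ^ n) := zero_add _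
  refine ⟨b, tendsto_iff_dist_tendsto_zero.2 (squeeze_zero (fun _ => dist_nonneg) hbound ?_)⟩
  simpa using (tendsto_pow_atTop_nhds_zero_of_lt_one (r := (1 / 2 : ℝ)) (by norm_num)
    (by norm_num)).const_mul 2

theorem totallyBounded_univ_quotientSpace (hr : 0 < r) :
    TotallyBounded (univ : Set (QuotientSpace r)) := by
  refine Metric.totallyBounded_iff.2 fun ε hε => ?_
  obtain ⟨n, hcode, hn⟩ := (((tendsto_codeError r).eventually_lt_const hε).and
    (eventually_gt_atTop 0)).exists
  obtain ⟨center, hcover⟩ := exists_cover_of_codeError_lt hr hn hcode le_rfl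
  exact ⟨range center, finite_range _, by rw [biUnion_range, hcover]⟩

theorem compactSpace_quotientSpace (hr : 0 < r) : CompactSpace (QuotientSpace r) :=
  ⟨(totallyBounded_univ_quotientSpace hr).isCompact_of_isClosed isClosed_univ⟩

end GraphonSignalSpace

end

theorem mainTheorem3_general (r : ℝ) (hr : 0 < r) :
    CompactSpace (GraphonSignalSpace.QuotientSpace r) ∧
    ∀ c : ℝ, 1 < c → ∃ ε₀ : ℝ, 0 < ε₀ ∧ ∀ ε : ℝ, 0 < ε → ε < ε₀ →
      ∀ k : ℕ, (2 : ℝ) ^ (c / ε ^ 2) ≤ k →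
        ∃ center : Fin (2 ^ (k ^ 2)) → GraphonSignalSpace.QuotientSpace r,
          (⋃ i, Metric.ball (center i) ε) = Set.univ :=
  ⟨GraphonSignalSpace.compactSpace_quotientSpace hr,
    fun _ hc => GraphonSignalSpace.exists_cover_of_rpow_le hr hc⟩

theorem mainTheorem3 (r : ℝ) (hr : 0 < r) :
    CompactSpace (GraphonSignalSpace.QuotientSpace r) ∧
    ∀ c : ℝ, 1 < c → ∃ ε₀ : ℝ, 0 < ε₀ ∧ ∀ ε : ℝ, 0 < ε → ε < ε₀ →
      ∀ k : ℕ, k = ⌈(2 : ℝ) ^ (9 * c / (4 * ε ^ 2))⌉₊ →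
        ∃ center : Fin (2 ^ (k ^ 2)) → GraphonSignalSpace.QuotientSpace r,
          (⋃ i, Metric.ball (center i) ε) = Set.univ := by
  obtain ⟨hcompact, hcover⟩ := mainTheorem3_general r hr
  refine ⟨hcompact, fun c hc => ?_⟩
  obtain ⟨ε₀, hε₀, hε⟩ := hcover (9 * c / 4) (by linarith)
  exact ⟨ε₀, hε₀, fun ε h0 hlt k hk => hε ε h0 hlt k (by rw [hk, div_div]; exact Nat.le_ceil _)⟩
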